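/- Let $R=\mathbb Z[A^{\pm1}]$ and $z=-A^2-A^{-2}$. For $n\ge 1$, a flat virtual $n$-tangle is a partition of $\{0,1\}\times\{1,\dots,n\}$ into pairs. Let $\mathrm{VTL}_n(R)$ be the free $R$-module on the set of flat virtual $n$-tangles, with the bilinear multiplication $E\,E'=z^m\,(E*E')$ defined as follows: concatenate the diagrams of $E$ and $E'$ by gluing the point $(1,i)$ of $E$ to the point $(0,i)$ of $E'$ for all $i$; the result consists of $m$ closed curves and $n$ arcs, and $E*E'$ is the flat virtual $n$-tangle formed by the pairs of end points of the arcs. This is an associative unital $R$-algebra, and it is a subalgebra of $\mathrm{VTL}_{n+1}(R)$ by $E\mapsto E\cup\{\{(0,n+1),(1,n+1)\}\}$. For $1\le i\le n-1$ let $E_i\in \mathrm{VTL}_n(R)$ be the tangle with pairs $\{(0,i),(0,i+1)\}$, $\{(1,i),(1,i+1)\}$ and $\{(0,j),(1,j)\}$ for $j\ne i,i+1$, let $v_i$ be the tangle with pairs $\{(0,i),(1,i+1)\}$, $\{(0,i+1),(1,i)\}$ and $\{(0,j),(1,j)\}$ for $j\neq i,i+1$, and let $S_i=-A^{-2}\,1-A^{-4}E_i$,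 which is invertible with inverse $-A^{2}\,1-A^{4}E_i$. For a flat virtual $n$-tangle $E$ let $t_n(E)$ be the number of closed curves obtained from the diagram of $E$ by connecting $(0,i)$ with $(1,i)$ by an arc for every $i$, and let $T_n:\mathrm{VTL}_n(R)\to R$ be the $R$-linear form with $T_n(E)=z^{t_n(E)}$ for every $E$. Then $\{T_n\}_{n\ge1}$ is a Markov trace, that is: 1. $T_n(xy)=T_n(yx)$ for all $n\ge1$ and all $x,y\in \mathrm{VTL}_n(R)$; 2. $T_n(x)=T_{n+1}(xS_n)=T_{n+1}(xS_n^{-1})=T_{n+1}(xv_n)$ for all $n\ge1$ and all $x\in \mathrm{VTL}_n(R)$; 3. $T_n(x)=T_{n+1}(xS_n^{-1}v_{n-1}S_n)$ for all $n\ge2$ and all $x\in \mathrm{VTL}_n(R)$; 4. $T_n(x)=T_{n+1}(xv_nv_{n-1}S_{n-1}v_nS_{n-1}^{-1}v_{n-1}v_n)$ for all $n\ge2$ and all $x\in \mathrm{VTL}_n(R)$. -/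

import Mathlib

namespace VirtualTL

section Setoids

variable {X Y B C : Type*}

/-- The number of classes of `r` that contain no point of the form `f b`. -/
noncomputable def freeClasses (r : Setoid X) (f : B → X) : ℕ :=
  Nat.card {c : Quotient r // ∀ b, Quotient.mk r (f b) ≠ c}

theorem map_le_iff {r : Setoid X} {f : X → Y} {t : Setoid Y} :
    r.map f ≤ t ↔ r ≤ t.comap f := by
  constructor
  · intro h x y hxy
    exact h (Setoid.le_comap_map hxy)
  · intro h
    refine Setoid.eqvGen_le ?_
    rintro _ _ ⟨a, b, hab, rfl, rfl⟩
    exact h hab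

theorem map_sup (r s : Setoid X) (f : X → Y) : (r ⊔ s).map f = r.map f ⊔ s.map f :=
  GaloisConnection.l_sup (u := fun t => Setoid.comap f t) (l := fun r => Setoid.map r f)
    (fun _ _ => map_le_iff)

theorem map_map (r : Setoid X) (f : X → Y) (g : Y → C) : (r.map f).map g = r.map (g ∘ f) := by
  apply le_antisymm
  · rw [map_le_iff, map_le_iff]; exact Setoid.le_comap_map
  · rw [map_le_iff]; intro x y h
    exact Setoid.le_comap_map (f := g) (Setoid.le_comap_map (f := f) h)

theorem map_apply {r : Setoid X} {f : X → Y} (hf : Function.Injective f) {x y : Y} :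
    r.map f x y ↔ x = y ∨ ∃ a b, r a b ∧ f a = x ∧ f b = y := by
  have h := Setoid.coe_map_of_ker_le r f (Setoid.ker_eq_bot_iff.2 hf ▸ bot_le)
  rw [show (r.map f x y ↔ _) ↔ ((r.map f : Y → Y → Prop) x y ↔ _) from Iff.rfl, h]
  exact or_comm

theorem sup_map_apply (r : Setoid X) (f : B → X) (s : Setoid B) {x y : X} :
    (r ⊔ s.map f) x y ↔ r x y ∨ ∃ b b', r x (f b) ∧ (r.comap f ⊔ s) b b' ∧ r (f b') y := by
  constructor
  · let t : Setoid X :=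
      { r := fun x y => r x y ∨ ∃ b b', r x (f b) ∧ (r.comap f ⊔ s) b b' ∧ r (f b') y
        iseqv := by
          refine ⟨fun x => Or.inl (r.refl' x), ?_, ?_⟩
          · rintro x y (h | ⟨b, b', h1, h2, h3⟩)
            · exact Or.inl (r.symm' h)
            · exact Or.inr ⟨b', b, r.symm' h3, Setoid.symm' _ h2, r.symm' h1⟩
          · rintro x y w (h | ⟨b, b', h1, h2, h3⟩) (k | ⟨c, c', k1, k2, k3⟩)
            · exact Or.inl (r.trans' h k)
            · exact Or.inr ⟨c, c', r.trans' h k1, k2, k3⟩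
            · exact Or.inr ⟨b, b', h1, h2, r.trans' h3 k⟩
            · refine Or.inr ⟨b, c', h1, Setoid.trans' _ h2 (Setoid.trans' _ ?_ k2), k3⟩
              exact (le_sup_left : r.comap f ≤ r.comap f ⊔ s) (r.trans' h3 k1) }
    have h : r ⊔ s.map f ≤ t := by
      refine sup_le (fun x y h => Or.inl h) ?_
      rw [map_le_iff]
      intro b b' h
      exact Or.inr ⟨b, b', r.refl' _, (le_sup_right : s ≤ r.comap f ⊔ s) h, r.refl' _⟩
    exact fun hxy => h hxy
  · have h1 : r ≤ r ⊔ s.map f := le_sup_left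
    have h2 : r.comap f ⊔ s ≤ (r ⊔ s.map f).comap f :=
      sup_le (fun _ _ h => h1 h) (map_le_iff.1 le_sup_right)
    rintro (h | ⟨b, b', k1, k2, k3⟩)
    · exact h1 h
    · exact Setoid.trans' _ (h1 k1) (Setoid.trans' _ (h2 k2) (h1 k3))

theorem comap_sup_map (r : Setoid X) (f : B → X) (s : Setoid B) :
    (r ⊔ s.map f).comap f = r.comap f ⊔ s := by
  ext b b'
  rw [Setoid.comap_rel, sup_map_apply]
  constructor
  · rintro (h | ⟨c, c', h1, h2, h3⟩)
    · exact (le_sup_left : r.comap f ≤ r.comap f ⊔ s) h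
    · exact Setoid.trans' _ ((le_sup_left : r.comap f ≤ r.comap f ⊔ s) h1)
        (Setoid.trans' _ h2 ((le_sup_left : r.comap f ≤ r.comap f ⊔ s) h3))
  · intro h
    exact Or.inr ⟨b, b', r.refl' _, h, r.refl' _⟩

theorem freeClasses_sup_map [Finite X] [Finite B] (r : Setoid X) (f : B → X) (s : Setoid B)
    (g : C → B) :
    freeClasses (r ⊔ s.map f) (f ∘ g) = freeClasses r f + freeClasses (r.comap f ⊔ s) g := by
  have hcs := comap_sup_map r f s
  unfold freeClasses
  rw [← Nat.card_sum]
  symm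
  have hle : r ≤ r ⊔ s.map f := le_sup_left
  refine Nat.card_congr (Equiv.ofBijective (Sum.elim
    (fun c => ⟨Quotient.map' (s₂ := r ⊔ s.map f) id (fun _ _ h => hle h) c.1, ?_⟩)
    (fun c => ⟨Quotient.map' (s₂ := r ⊔ s.map f) f (fun b b' h => by
        rw [← hcs] at h; exact h) c.1, ?_⟩)) ⟨?_, ?_⟩)
  · rcases c with ⟨c, hc⟩
    induction c using Quotient.inductionOn with | _ x =>
    intro k h
    rcases (sup_map_apply r f s).1 (Quotient.exact h) with h | ⟨b, b', h1, h2, h3⟩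
    · exact hc _ (Quotient.sound h)
    · exact hc _ (Quotient.sound h3)
  · rcases c with ⟨c, hc⟩
    induction c using Quotient.inductionOn with | _ x =>
    intro k h
    have := Quotient.exact h
    refine hc k (Quotient.sound ?_)
    change (r.comap f ⊔ s) _ _
    rw [← hcs]; exact this
  · rintro (⟨c, hc⟩ | ⟨c, hc⟩) (⟨d, hd⟩ | ⟨d, hd⟩) h
    · induction c using Quotient.inductionOn with | _ x =>
      induction d using Quotient.inductionOn with | _ y =>
      have h' := Quotient.exact (Subtype.ext_iff.1 h)
      rcases (sup_map_apply r f s).1 h' with h | ⟨b, b', h1, h2, h3⟩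
      · congr 2; exact Quotient.sound h
      · exact (hc _ (Quotient.sound (r.symm' h1))).elim
    · induction c using Quotient.inductionOn with | _ x =>
      induction d using Quotient.inductionOn with | _ y =>
      have h' := Quotient.exact (Subtype.ext_iff.1 h)
      rcases (sup_map_apply r f s).1 h' with h | ⟨b, b', h1, h2, h3⟩
      · exact (hc _ (Quotient.sound (r.symm' h))).elim
      · exact (hc _ (Quotient.sound (r.symm' h1))).elim
    · induction c using Quotient.inductionOn with | _ x =>
      induction d using Quotient.inductionOn with | _ y =>
      have h' := Quotient.exact (Subtype.ext_iff.1 h)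
      rcases (sup_map_apply r f s).1 h' with h | ⟨b, b', h1, h2, h3⟩
      · exact (hd _ (Quotient.sound h)).elim
      · exact (hd _ (Quotient.sound h3)).elim
    · induction c using Quotient.inductionOn with | _ x =>
      induction d using Quotient.inductionOn with | _ y =>
      have h' := Quotient.exact (Subtype.ext_iff.1 h)
      congr 2; apply Quotient.sound
      change (r.comap f ⊔ s) _ _
      rw [← hcs]; exact h'
  · rintro ⟨c, hc⟩
    induction c using Quotient.inductionOn with | _ x =>
    by_cases hx : ∃ b, r (f b) x
    · obtain ⟨b, hb⟩ := hx
      refine ⟨Sum.inr ⟨Quotient.mk _ b, ?_⟩, ?_⟩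
      · intro k h
        refine hc k (Quotient.sound ?_)
        have h' : (r.comap f ⊔ s) (g k) b := Quotient.exact h
        rw [← hcs] at h'
        exact Setoid.trans' _ h' (hle hb)
      · exact Subtype.ext (Quotient.sound (hle hb))
    · exact ⟨Sum.inl ⟨Quotient.mk _ x, fun b h => hx ⟨b, Quotient.exact h⟩⟩, rfl⟩

/-- Enlarging the ambient set by points that are all in the image of `f'`. -/
theorem comap_map_square {X' B' : Type*} {r : Setoid X} {j : X → X'} {f : B → X}
    {f' : B' → X'} {k : B → B'} (hj : Function.Injective j) (hf' : Function.Injective f')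
    (hk : Function.Injective k) (hcomm : ∀ b, f' (k b) = j (f b))
    (hpb : ∀ b' x, f' b' = j x → ∃ b, k b = b' ∧ f b = x) :
    (r.map j).comap f' = (r.comap f).map k := by
  ext u v
  rw [Setoid.comap_rel, map_apply hj, map_apply hk]
  constructor
  · rintro (h | ⟨a, b, hab, h1, h2⟩)
    · exact Or.inl (hf' h)
    · obtain ⟨c, rfl, rfl⟩ := hpb _ _ h1.symm
      obtain ⟨d, rfl, rfl⟩ := hpb _ _ h2.symm
      exact Or.inr ⟨c, d, hab, rfl, rfl⟩
  · rintro (h | ⟨a, b, hab, rfl, rfl⟩)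
    · exact Or.inl (congrArg _ h)
    · exact Or.inr ⟨f a, f b, hab, (hcomm _).symm, (hcomm _).symm⟩

theorem freeClasses_map_square {X' B' : Type*} {r : Setoid X} {j : X → X'} {f : B → X}
    {f' : B' → X'} {k : B → B'} (hj : Function.Injective j)
    (hcomm : ∀ b, f' (k b) = j (f b))
    (hpb : ∀ b' x, f' b' = j x → ∃ b, k b = b' ∧ f b = x)
    (hcov : ∀ x', (∃ x, j x = x') ∨ ∃ b', f' b' = x') :
    freeClasses (r.map j) f' = freeClasses r f := by
  unfold freeClasses
  symm
  refine Nat.card_congr (Equiv.ofBijective (fun c => ⟨Quotient.map' (s₂ := r.map j) j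
    (fun a b h => (Setoid.le_comap_map h : _)) c.1, ?_⟩) ⟨?_, ?_⟩)
  · rcases c with ⟨c, hc⟩
    induction c using Quotient.inductionOn with | _ x =>
    intro b' h
    rcases (map_apply hj).1 (Quotient.exact h) with h | ⟨a, b, hab, h1, h2⟩
    · obtain ⟨b, rfl, rfl⟩ := hpb _ _ h
      exact hc b rfl
    · obtain ⟨b, rfl, rfl⟩ := hpb _ _ h1.symm
      have h2 := hj h2
      subst h2
      exact hc b (Quotient.sound hab)
  · rintro ⟨c, hc⟩ ⟨d, hd⟩ h
    induction c using Quotient.inductionOn with | _ x =>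
    induction d using Quotient.inductionOn with | _ y =>
    have h' := Quotient.exact (Subtype.ext_iff.1 h)
    congr 1
    apply Quotient.sound
    have : (r.map j).comap j x y := h'
    rwa [Setoid.comap_map_eq j r hj] at this
  · rintro ⟨c, hc⟩
    induction c using Quotient.inductionOn with | _ x =>
    rcases hcov x with ⟨y, rfl⟩ | ⟨b', rfl⟩
    · refine ⟨⟨Quotient.mk _ y, fun b h => hc (k b) (Quotient.sound ?_)⟩, rfl⟩
      change r.map j _ _
      rw [hcomm]
      exact (Setoid.le_comap_map (Quotient.exact h : r _ _) : _)
    · exact (hc b' rfl).elim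

/-- In the orbits of a pair of involutions without common fixed points, the points fixed by one of
the two involutions come in pairs. -/
theorem ncard_ends [Finite X] (a b : X → X) (ha : Function.Involutive a)
    (hb : Function.Involutive b) (hab : ∀ x, ¬ (a x = x ∧ b x = x)) (s : Setoid X)
    (hs : s = Relation.EqvGen.setoid fun x y => y = a x ∨ y = b x) (x₀ : X)
    (h₀ : a x₀ = x₀ ∨ b x₀ = x₀) :
    {x | s x x₀ ∧ (a x = x ∨ b x = x)}.ncard = 2 := by
  classical
  have _ := Fintype.ofFinite X
  have hsa : ∀ x, s x (a x) := fun x => by rw [hs]; exact .rel _ _ (Or.inl rfl)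
  have hsb : ∀ x, s x (b x) := fun x => by rw [hs]; exact .rel _ _ (Or.inr rfl)
  let K := {x // s x x₀}
  let a' : K → K := fun x => ⟨a x.1, s.trans' (s.symm' (hsa _)) x.2⟩
  let b' : K → K := fun x => ⟨b x.1, s.trans' (s.symm' (hsb _)) x.2⟩
  have ha' : Function.Involutive a' := fun x => Subtype.ext (ha x.1)
  have hb' : Function.Involutive b' := fun x => Subtype.ext (hb x.1)
  have hab' : ∀ x, ¬ (a' x = x ∧ b' x = x) := fun x h =>
    hab x.1 ⟨congrArg Subtype.val h.1, congrArg Subtype.val h.2⟩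
  let G : SimpleGraph K := SimpleGraph.fromRel fun x y => y = a' x ∨ y = b' x
  have hreach : ∀ x y : X, Relation.EqvGen (fun x y => y = a x ∨ y = b x) x y →
      ∀ (hx : s x x₀) (hy : s y x₀), G.Reachable ⟨x, hx⟩ ⟨y, hy⟩ := by
    intro x y h
    induction h with
    | rel x y h =>
      intro hx hy
      by_cases hxy : x = y
      · subst hxy; exact .refl _
      · refine SimpleGraph.Adj.reachable ?_
        rw [SimpleGraph.fromRel_adj]
        exact ⟨fun h => hxy (congrArg Subtype.val h),
          Or.inl (h.imp (fun h => Subtype.ext h) (fun h => Subtype.ext h))⟩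
    | refl x => intro hx hy; exact .refl _
    | symm x y _ ih => intro hx hy; exact (ih hy hx).symm
    | trans x y w hxy _ ih1 ih2 =>
      intro hx hw
      have hy : s y x₀ := by
        refine s.trans' (s.symm' ?_) hx
        rw [hs]; exact hxy
      exact (ih1 hx hy).trans (ih2 hy hw)
  have hG : G.Connected := by
    have : Nonempty K := ⟨⟨x₀, s.refl' _⟩⟩
    refine SimpleGraph.Connected.mk ?_
    rintro ⟨x, hx⟩ ⟨y, hy⟩
    refine hreach x y ?_ hx hy
    have := s.trans' hx (s.symm' hy)
    rw [hs] at this; exact this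
  have hcard := hG.card_vert_le_card_edgeSet_add_one
  rw [Nat.card_eq_fintype_card, Nat.card_eq_fintype_card, ← SimpleGraph.edgeFinset_card] at hcard
  have hdeg := G.sum_degrees_eq_twice_card_edges
  let F : Finset K := Finset.univ.filter fun x => a' x = x ∨ b' x = x
  have hd : ∀ x, G.degree x + (if a' x = x ∨ b' x = x then 1 else 0) ≤ 2 := by
    intro x
    have hsub : G.neighborFinset x ⊆ ({a' x, b' x} : Finset K).erase x := by
      intro y hy
      rw [SimpleGraph.mem_neighborFinset, SimpleGraph.fromRel_adj] at hy
      obtain ⟨hne, h⟩ := hy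
      rw [Finset.mem_erase, Finset.mem_insert, Finset.mem_singleton]
      refine ⟨hne.symm, ?_⟩
      rcases h with h | h | h
      · exact h
      · left; rw [h, ha']
      · right; rw [h, hb']
    have h1 := Finset.card_le_card hsub
    rw [SimpleGraph.card_neighborFinset_eq_degree] at h1
    have h2 : ({a' x, b' x} : Finset K).card ≤ 2 := Finset.card_le_two
    split_ifs with h
    · have hmem : x ∈ ({a' x, b' x} : Finset K) := by
        rw [Finset.mem_insert, Finset.mem_singleton]
        exact h.imp Eq.symm Eq.symm
      rw [Finset.card_erase_of_mem hmem] at h1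
      omega
    · have := Finset.card_erase_le (s := ({a' x, b' x} : Finset K)) (a := x)
      omega
  have hsum := Finset.sum_le_sum fun x (_ : x ∈ Finset.univ) => hd x
  rw [Finset.sum_add_distrib, hdeg, Finset.sum_const, smul_eq_mul, Finset.card_univ,
    ← Finset.card_filter] at hsum
  have hF2 : F.card ≤ 2 := by
    change (Finset.univ.filter fun x => a' x = x ∨ b' x = x).card ≤ 2
    omega
  have hpos : 0 < F.card := Finset.card_pos.2 ⟨⟨x₀, s.refl' _⟩, by
    simp only [F, Finset.mem_filter, Finset.mem_univ, true_and]
    exact h₀.imp (fun h => Subtype.ext h) (fun h => Subtype.ext h)⟩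
  have hpar : ∀ (c : K → K), Function.Involutive c →
      Fintype.card K ≡ (Finset.univ.filter fun x => c x = x).card [MOD 2] := by
    intro c hc
    have := Equiv.Perm.card_fixedPoints_modEq (f := (c : Function.End K)) (p := 2) (n := 1) (by
      funext x; exact hc x)
    refine this.trans ?_
    rw [Fintype.card_subtype]
    exact Nat.ModEq.refl _
  have hFdisj : F.card = (Finset.univ.filter fun x => a' x = x).card +
      (Finset.univ.filter fun x => b' x = x).card := by
    rw [← Finset.card_union_of_disjoint, ← Finset.filter_or]
    rw [Finset.disjoint_filter]
    intro x _ h1 h2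
    exact hab' x ⟨h1, h2⟩
  have h1 := hpar a' ha'
  have h2 := hpar b' hb'
  have hF : F.card = 2 := by
    unfold Nat.ModEq at h1 h2
    omega
  rw [← hF]
  have : {x | s x x₀ ∧ (a x = x ∨ b x = x)} = Subtype.val '' (F : Set K) := by
    ext x
    simp only [Set.mem_ofPred_eq, Set.mem_image, F, Finset.coe_filter, Finset.mem_univ, true_and]
    constructor
    · rintro ⟨h1, h2⟩
      exact ⟨⟨x, h1⟩, h2.imp (fun h => Subtype.ext h) (fun h => Subtype.ext h), rfl⟩
    · rintro ⟨y, h, rfl⟩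
      exact ⟨y.2, h.imp (congrArg Subtype.val) (congrArg Subtype.val)⟩
  rw [this, Set.ncard_image_of_injective _ Subtype.val_injective, Set.ncard_coe_finset]

end Setoids

/-- The set `{0,1} × {1,…,n}` of end points of a diagram on `n` strands. -/
abbrev Pt (n : ℕ) : Type := Fin 2 × Fin n

/-- A flat virtual `n`-tangle: a partition of `{0,1} × {1,…,n}` into pairs. -/
@[ext]
structure FlatTangle (n : ℕ) where
  /-- the partition, as an equivalence relation -/
  rel : Setoid (Pt n)
  /-- every part is a pair -/
  pairs : ∀ c ∈ rel.classes, c.ncard = 2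

namespace FlatTangle

variable {n : ℕ}

/-- The flat virtual tangle whose pairs are the orbits of a fixed point free involution. -/
def ofInvolution (σ : Pt n → Pt n) (hσ : Function.Involutive σ) (hfix : ∀ p, σ p ≠ p) :
    FlatTangle n where
  rel :=
    { r := fun p q => q = p ∨ q = σ p
      iseqv := by
        refine ⟨fun p => Or.inl rfl, ?_, ?_⟩
        · rintro p q (rfl | rfl)
          · exact Or.inl rfl
          · exact Or.inr (hσ p).symm
        · rintro p q r (rfl | rfl) (rfl | rfl)
          · exact Or.inl rfl
          · exact Or.inr rfl
          · exact Or.inr rfl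
          · exact Or.inl (hσ p) }
  pairs := by
    rintro _ ⟨p, rfl⟩
    have : {q : Pt n | p = q ∨ p = σ q} = {p, σ p} := by
      ext q
      simp only [Set.mem_ofPred_eq, Set.mem_insert_iff, Set.mem_singleton_iff]
      refine or_congr eq_comm ⟨fun h => ?_, fun h => ?_⟩
      · rw [h, hσ]
      · rw [h, hσ]
    exact this ▸ Set.ncard_pair (hfix p).symm

theorem exists_involution (E : FlatTangle n) : ∃ σ : Pt n → Pt n, Function.Involutive σ ∧
    (∀ p, σ p ≠ p) ∧ ∀ p q, E.rel p q ↔ q = p ∨ q = σ p := by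
  have h : ∀ p, ∃ p', p' ≠ p ∧ ∀ q, E.rel p q ↔ q = p ∨ q = p' := by
    intro p
    have h := E.pairs _ (E.rel.mem_classes p)
    obtain ⟨x, y, hxy, hset⟩ := Set.ncard_eq_two.1 h
    have hmem : ∀ q, E.rel p q ↔ q = x ∨ q = y := by
      intro q
      have := Set.ext_iff.1 hset q
      simp only [Set.mem_ofPred_eq, Set.mem_insert_iff, Set.mem_singleton_iff] at this
      rw [← this]; exact E.rel.comm'
    rcases (hmem p).1 (E.rel.refl' p) with rfl | rfl
    · exact ⟨y, hxy.symm, hmem⟩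
    · exact ⟨x, hxy, fun q => (hmem q).trans or_comm⟩
  choose σ h1 h2 using h
  refine ⟨σ, fun p => ?_, h1, h2⟩
  have h3 : E.rel (σ p) p := E.rel.symm' ((h2 p _).2 (Or.inr rfl))
  rcases (h2 (σ p) p).1 h3 with h | h
  · exact (h1 p h.symm).elim
  · exact h.symm

end FlatTangle

section Concat

variable {n : ℕ}

/-- The end points of the first diagram among the points `{0,1,2} × {1,…,n}` of a concatenation. -/
def firstPt (p : Pt n) : Fin 3 × Fin n := (p.1.castSucc, p.2)

/-- The end points of the second diagram in a concatenation: its points `(0,i)` are glued to the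
points `(1,i)` of the first one. -/
def secondPt (p : Pt n) : Fin 3 × Fin n := (p.1.succ, p.2)

/-- The end points of the concatenation. -/
def outerPt (p : Pt n) : Fin 3 × Fin n := (![0, 2] p.1, p.2)

theorem firstPt_injective : Function.Injective (firstPt (n := n)) := by
  rintro ⟨a, i⟩ ⟨b, j⟩ h
  simpa [firstPt] using h

theorem secondPt_injective : Function.Injective (secondPt (n := n)) := by
  rintro ⟨a, i⟩ ⟨b, j⟩ h
  simpa [secondPt] using h

theorem outerPt_injective : Function.Injective (outerPt (n := n)) := by
  rintro ⟨a, i⟩ ⟨b, j⟩ h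
  simp only [outerPt, Prod.mk.injEq] at h ⊢
  refine ⟨?_, h.2⟩
  have := h.1
  fin_cases a <;> fin_cases b <;> simp_all

/-- The connected components of the concatenation of the diagrams of `E` and `E'`. -/
def stack (E E' : FlatTangle n) : Setoid (Fin 3 × Fin n) :=
  E.rel.map firstPt ⊔ E'.rel.map secondPt

/-- The number of closed curves in the concatenation of `E` and `E'`: the components that contain
no end point. -/
noncomputable def loops (E E' : FlatTangle n) : ℕ := freeClasses (stack E E') outerPt

theorem extend_fix {X B : Type*} {f : B → X} (hf : Function.Injective f) {σ : B → B}
    (hfix : ∀ p, σ p ≠ p) (x : X) :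
    Function.extend f (f ∘ σ) id x = x ↔ x ∉ Set.range f := by
  by_cases hx : ∃ b, f b = x
  · obtain ⟨b, rfl⟩ := hx
    rw [hf.extend_apply]
    exact ⟨fun h => (hfix b (hf h)).elim, fun h => (h ⟨b, rfl⟩).elim⟩
  · rw [Function.extend_apply' _ _ _ hx]
    exact ⟨fun _ => hx, fun _ => rfl⟩

theorem extend_involutive {X B : Type*} {f : B → X} (hf : Function.Injective f) {σ : B → B}
    (hσ : Function.Involutive σ) : Function.Involutive (Function.extend f (f ∘ σ) id) := by
  intro x
  by_cases hx : ∃ b, f b = x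
  · obtain ⟨b, rfl⟩ := hx
    rw [hf.extend_apply, Function.comp, hf.extend_apply, Function.comp, hσ]
  · rw [Function.extend_apply' _ _ _ hx, id, Function.extend_apply' _ _ _ hx, id]

theorem map_le_iff_extend {X B : Type*} {f : B → X} (hf : Function.Injective f) {σ : B → B}
    {r : Setoid B} (hr : ∀ p q, r p q ↔ q = p ∨ q = σ p) (t : Setoid X) :
    r.map f ≤ t ↔ ∀ x, t x (Function.extend f (f ∘ σ) id x) := by
  rw [map_le_iff]
  constructor
  · intro h x
    by_cases hx : ∃ b, f b = x
    · obtain ⟨b, rfl⟩ := hx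
      rw [hf.extend_apply]
      exact h ((hr _ _).2 (Or.inr rfl))
    · rw [Function.extend_apply' _ _ _ hx]; exact t.refl' _
  · intro h p q hpq
    rcases (hr _ _).1 hpq with rfl | rfl
    · exact Setoid.refl' _ _
    · have := h (f p)
      rw [hf.extend_apply] at this
      exact this

theorem concat_pairs (E E' : FlatTangle n) :
    ∀ c ∈ ((stack E E').comap outerPt).classes, c.ncard = 2 := by
  rintro _ ⟨p, rfl⟩
  obtain ⟨σ, hσ, hfix, hE⟩ := E.exists_involution
  obtain ⟨σ', hσ', hfix', hE'⟩ := E'.exists_involution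
  have hends : ∀ x : Fin 3 × Fin n,
      (x ∉ Set.range firstPt ∨ x ∉ Set.range secondPt) ↔ x ∈ Set.range outerPt := by
    rintro ⟨a, i⟩
    simp only [Set.mem_range, Prod.exists, firstPt, secondPt, outerPt, Prod.mk.injEq,
      exists_eq_right, Fin.exists_fin_two]
    fin_cases a <;> simp [Fin.ext_iff]
  have hnot : ∀ x : Fin 3 × Fin n, ¬ (x ∉ Set.range firstPt ∧ x ∉ Set.range secondPt) := by
    rintro ⟨a, i⟩
    simp only [Set.mem_range, Prod.exists, firstPt, secondPt, Prod.mk.injEq,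
      Fin.exists_fin_two]
    fin_cases a <;> simp [Fin.ext_iff]
  have h := ncard_ends _ _ (extend_involutive firstPt_injective hσ)
    (extend_involutive secondPt_injective hσ')
    (by
      intro x
      rw [extend_fix firstPt_injective hfix, extend_fix secondPt_injective hfix']
      exact hnot x)
    (stack E E')
    (by
      apply le_antisymm
      · refine sup_le ?_ ?_
        · rw [map_le_iff_extend firstPt_injective hE]
          exact fun x => .rel _ _ (Or.inl rfl)
        · rw [map_le_iff_extend secondPt_injective hE']
          exact fun x => .rel _ _ (Or.inr rfl)
      · refine Setoid.eqvGen_le ?_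
        rintro x y (rfl | rfl)
        · exact (map_le_iff_extend firstPt_injective hE _).1 le_sup_left x
        · exact (map_le_iff_extend secondPt_injective hE' _).1 le_sup_right x)
    (outerPt p)
    (by
      rw [extend_fix firstPt_injective hfix, extend_fix secondPt_injective hfix', hends]
      exact ⟨p, rfl⟩)
  rw [← h, ← Set.ncard_image_of_injective _ outerPt_injective]
  congr 1
  ext x
  rw [Set.mem_ofPred_eq, extend_fix firstPt_injective hfix, extend_fix secondPt_injective hfix',
    hends]
  constructor
  · rintro ⟨q, hq, rfl⟩
    exact ⟨hq, q, rfl⟩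
  · rintro ⟨hq, q, rfl⟩
    exact ⟨q, hq, rfl⟩

/-- The flat virtual tangle `E * E'` whose pairs are the end points of the arcs in the
concatenation of `E` and `E'`. -/
def concat (E E' : FlatTangle n) : FlatTangle n where
  rel := (stack E E').comap outerPt
  pairs := concat_pairs E E'

/-- The points of a threefold concatenation that remain when the second level is forgotten. -/
def keep023 (p : Fin 3 × Fin n) : Fin 4 × Fin n := (![0, 2, 3] p.1, p.2)

/-- The points of a threefold concatenation that remain when the third level is forgotten. -/
def keep013 (p : Fin 3 × Fin n) : Fin 4 × Fin n := (![0, 1, 3] p.1, p.2)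

/-- The first two diagrams of a threefold concatenation. -/
def firstTwo (p : Fin 3 × Fin n) : Fin 4 × Fin n := (p.1.castSucc, p.2)

/-- The last two diagrams of a threefold concatenation. -/
def lastTwo (p : Fin 3 × Fin n) : Fin 4 × Fin n := (p.1.succ, p.2)

theorem prodMap_injective {k m : ℕ} {g : Fin k → Fin m} (hg : Function.Injective g) :
    Function.Injective (fun p : Fin k × Fin n => (g p.1, p.2)) := by
  rintro ⟨a, i⟩ ⟨b, j⟩ h
  simp only [Prod.mk.injEq] at h ⊢
  exact ⟨hg h.1, h.2⟩

theorem firstTwo_injective : Function.Injective (firstTwo (n := n)) :=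
  prodMap_injective (by decide)

theorem lastTwo_injective : Function.Injective (lastTwo (n := n)) :=
  prodMap_injective (by decide)

theorem keep023_injective : Function.Injective (keep023 (n := n)) :=
  prodMap_injective (by decide)

theorem keep013_injective : Function.Injective (keep013 (n := n)) :=
  prodMap_injective (by decide)

theorem level_ext {X : Type*} {k : ℕ} {f g : Fin k × Fin n → X}
    (h : ∀ a i, f (a, i) = g (a, i)) : f = g := funext fun p => h p.1 p.2

theorem stack_left (E E' : FlatTangle n) :
    ((stack E E').map firstTwo).comap keep023 = (concat E E').rel.map firstPt ∧
      freeClasses ((stack E E').map firstTwo) keep023 = loops E E' := by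
  have hcomm : ∀ b : Pt n, keep023 (firstPt b) = firstTwo (outerPt b) := by
    rintro ⟨a, i⟩; fin_cases a <;> rfl
  have hpb : ∀ (b' : Fin 3 × Fin n) x, keep023 b' = firstTwo x →
      ∃ b : Pt n, firstPt b = b' ∧ outerPt b = x := by
    rintro ⟨a, i⟩ ⟨b, j⟩ h
    simp only [keep023, firstTwo, Prod.mk.injEq] at h
    obtain ⟨h, rfl⟩ := h
    have : ∀ a b : Fin 3, (![0, 2, 3] a : Fin 4) = b.castSucc →
      ∃ c : Fin 2, c.castSucc = a ∧ (![0, 2] c : Fin 3) = b := by decide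
    obtain ⟨c, h1, h2⟩ := this a b h
    exact ⟨(c, i), Prod.ext h1 rfl, Prod.ext h2 rfl⟩
  refine ⟨comap_map_square firstTwo_injective keep023_injective firstPt_injective hcomm hpb,
    freeClasses_map_square firstTwo_injective hcomm hpb ?_⟩
  rintro ⟨a, i⟩
  have : ∀ a : Fin 4, (∃ x : Fin 3, x.castSucc = a) ∨ ∃ b : Fin 3, (![0, 2, 3] b : Fin 4) = a := by
    decide
  rcases this a with ⟨x, rfl⟩ | ⟨x, rfl⟩
  · exact Or.inl ⟨(x, i), rfl⟩
  · exact Or.inr ⟨(x, i), rfl⟩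

theorem stack_right (E E' : FlatTangle n) :
    ((stack E E').map lastTwo).comap keep013 = (concat E E').rel.map secondPt ∧
      freeClasses ((stack E E').map lastTwo) keep013 = loops E E' := by
  have hcomm : ∀ b : Pt n, keep013 (secondPt b) = lastTwo (outerPt b) := by
    rintro ⟨a, i⟩; fin_cases a <;> rfl
  have hpb : ∀ (b' : Fin 3 × Fin n) x, keep013 b' = lastTwo x →
      ∃ b : Pt n, secondPt b = b' ∧ outerPt b = x := by
    rintro ⟨a, i⟩ ⟨b, j⟩ h
    simp only [keep013, lastTwo, Prod.mk.injEq] at h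
    obtain ⟨h, rfl⟩ := h
    have : ∀ a b : Fin 3, (![0, 1, 3] a : Fin 4) = b.succ →
      ∃ c : Fin 2, c.succ = a ∧ (![0, 2] c : Fin 3) = b := by decide
    obtain ⟨c, h1, h2⟩ := this a b h
    exact ⟨(c, i), Prod.ext h1 rfl, Prod.ext h2 rfl⟩
  refine ⟨comap_map_square lastTwo_injective keep013_injective secondPt_injective hcomm hpb,
    freeClasses_map_square lastTwo_injective hcomm hpb ?_⟩
  rintro ⟨a, i⟩
  have : ∀ a : Fin 4, (∃ x : Fin 3, x.succ = a) ∨ ∃ b : Fin 3, (![0, 1, 3] b : Fin 4) = a := by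
    decide
  rcases this a with ⟨x, rfl⟩ | ⟨x, rfl⟩
  · exact Or.inl ⟨(x, i), rfl⟩
  · exact Or.inr ⟨(x, i), rfl⟩

theorem concat_assoc_aux (E E' E'' : FlatTangle n) :
    concat (concat E E') E'' = concat E (concat E' E'') ∧
      loops E E' + loops (concat E E') E'' = loops E' E'' + loops E (concat E' E'') := by
  let R := (stack E E').map firstTwo ⊔ (E''.rel.map secondPt).map keep023
  have hR : R = (stack E' E'').map lastTwo ⊔ (E.rel.map firstPt).map keep013 := by
    simp only [R, stack, map_sup, map_map]
    have h1 : keep023 ∘ secondPt (n := n) = lastTwo ∘ secondPt := by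
      apply level_ext; intro a i; fin_cases a <;> rfl
    have h2 : firstTwo ∘ secondPt (n := n) = lastTwo ∘ firstPt := by
      apply level_ext; intro a i; fin_cases a <;> rfl
    have h3 : firstTwo ∘ firstPt (n := n) = keep013 ∘ firstPt := by
      apply level_ext; intro a i; fin_cases a <;> rfl
    rw [h1, h2, h3, sup_assoc, sup_comm]
  have h4 : keep023 ∘ outerPt (n := n) = keep013 ∘ outerPt := by
    apply level_ext; intro a i; fin_cases a <;> rfl
  have hL : R.comap keep023 = stack (concat E E') E'' := by
    rw [comap_sup_map, (stack_left E E').1]; rfl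
  have hL' : R.comap keep013 = stack E (concat E' E'') := by
    rw [hR, comap_sup_map, (stack_right E' E'').1, sup_comm]; rfl
  constructor
  · apply FlatTangle.ext
    change (stack (concat E E') E'').comap outerPt = (stack E (concat E' E'')).comap outerPt
    rw [← hL, ← hL']
    exact congrArg (fun f => R.comap f) h4
  · have e1 : freeClasses R (keep023 ∘ outerPt) = loops E E' + loops (concat E E') E'' := by
      rw [freeClasses_sup_map, (stack_left E E').2, (stack_left E E').1]; rfl
    have e2 : freeClasses R (keep013 ∘ outerPt) = loops E' E'' + loops E (concat E' E'') := by
      rw [hR, freeClasses_sup_map, (stack_right E' E'').2, (stack_right E' E'').1, sup_comm]; rfl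
    rw [← e1, ← e2, h4]

/-- The identity tangle, with pairs `{(0,i),(1,i)}`. -/
def idTangle (n : ℕ) : FlatTangle n :=
  FlatTangle.ofInvolution (fun p => (p.1.rev, p.2)) (fun p => by simp)
    (fun p h => by
      have : ∀ a : Fin 2, a.rev ≠ a := by decide
      exact this p.1 (congrArg Prod.fst h))

theorem idTangle_rel (p q : Pt n) : (idTangle n).rel p q ↔ p.2 = q.2 := by
  change (q = p ∨ q = (p.1.rev, p.2)) ↔ _
  rw [Prod.ext_iff, Prod.ext_iff]
  have : ∀ a b : Fin 2, b = a ∨ b = a.rev := by decide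
  have := this p.1 q.1
  constructor
  · rintro (h | h) <;> exact h.2.symm
  · intro h
    exact this.imp (fun h' => ⟨h', h.symm⟩) (fun h' => ⟨h', h.symm⟩)

theorem concat_of_collapse {E E' F : FlatTangle n} (φ : Fin 3 × Fin n → Pt n)
    (h : stack E E' = F.rel.comap φ) (hφ : ∀ p, φ (outerPt p) = p) :
    concat E E' = F ∧ loops E E' = 0 := by
  constructor
  · apply FlatTangle.ext
    change (stack E E').comap outerPt = _
    rw [h, ← Setoid.comap_comp, show φ ∘ outerPt = id from funext hφ, Setoid.comap_id]
  · unfold loops freeClasses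
    rw [Nat.card_eq_zero]
    refine Or.inl ⟨?_⟩
    rintro ⟨c, hc⟩
    induction c using Quotient.inductionOn with | _ x =>
    refine hc (φ x) (Quotient.sound ?_)
    change stack E E' _ _
    rw [h, Setoid.comap_rel, hφ]

theorem concat_id_aux (E : FlatTangle n) : concat E (idTangle n) = E ∧ loops E (idTangle n) = 0 := by
  refine concat_of_collapse (fun p => (![0, 1, 1] p.1, p.2)) ?_ ?_
  · apply le_antisymm
    · refine sup_le ?_ ?_ <;> rw [map_le_iff]
      · rintro ⟨a, i⟩ ⟨b, j⟩ h
        simp only [Setoid.comap_rel, firstPt]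
        have : ∀ a : Fin 2, (![0, 1, 1] a.castSucc : Fin 2) = a := by decide
        rw [this, this]; exact h
      · rintro ⟨a, i⟩ ⟨b, j⟩ h
        simp only [Setoid.comap_rel, secondPt]
        obtain rfl : i = j := (idTangle_rel _ _).1 h
        have : ∀ a : Fin 2, (![0, 1, 1] a.succ : Fin 2) = 1 := by decide
        rw [this, this]
    · have key : ∀ p : Fin 3 × Fin n,
          stack E (idTangle n) p (firstPt (![0, 1, 1] p.1, p.2)) := by
        rintro ⟨a, i⟩
        fin_cases a
        · exact Setoid.refl' _ _
        · exact Setoid.refl' _ _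
        · exact (map_le_iff.1 (le_sup_right : _ ≤ stack E (idTangle n)))
            ((idTangle_rel (1, i) (0, i)).2 rfl)
      intro p q h
      exact Setoid.trans' _ (key p) (Setoid.trans' _
        ((map_le_iff.1 (le_sup_left : _ ≤ stack E (idTangle n))) h) (Setoid.symm' _ (key q)))
  · rintro ⟨a, i⟩; fin_cases a <;> rfl

theorem id_concat_aux (E : FlatTangle n) : concat (idTangle n) E = E ∧ loops (idTangle n) E = 0 := by
  refine concat_of_collapse (fun p => (![0, 0, 1] p.1, p.2)) ?_ ?_
  · apply le_antisymm
    · refine sup_le ?_ ?_ <;> rw [map_le_iff]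
      · rintro ⟨a, i⟩ ⟨b, j⟩ h
        simp only [Setoid.comap_rel, firstPt]
        obtain rfl : i = j := (idTangle_rel _ _).1 h
        have : ∀ a : Fin 2, (![0, 0, 1] a.castSucc : Fin 2) = 0 := by decide
        rw [this, this]
      · rintro ⟨a, i⟩ ⟨b, j⟩ h
        simp only [Setoid.comap_rel, secondPt]
        have : ∀ a : Fin 2, (![0, 0, 1] a.succ : Fin 2) = a := by decide
        rw [this, this]; exact h
    · have key : ∀ p : Fin 3 × Fin n,
          stack (idTangle n) E p (secondPt (![0, 0, 1] p.1, p.2)) := by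
        rintro ⟨a, i⟩
        fin_cases a
        · exact (map_le_iff.1 (le_sup_left : _ ≤ stack (idTangle n) E))
            ((idTangle_rel (0, i) (1, i)).2 rfl)
        · exact Setoid.refl' _ _
        · exact Setoid.refl' _ _
      intro p q h
      exact Setoid.trans' _ (key p) (Setoid.trans' _
        ((map_le_iff.1 (le_sup_right : _ ≤ stack (idTangle n) E)) h) (Setoid.symm' _ (key q)))
  · rintro ⟨a, i⟩; fin_cases a <;> rfl

end Concat

section Strand

variable {k n : ℕ}

/-- The inclusion of the first `n` strands into `n + 1` strands. -/
def inclPt (p : Fin k × Fin n) : Fin k × Fin (n + 1) := (p.1, p.2.castSucc)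

/-- The points of the last strand. -/
def lastPt (n : ℕ) (a : Fin k) : Fin k × Fin (n + 1) := (a, Fin.last n)

/-- The equivalence relation `r` with one more class, consisting of the points of a new last
strand. -/
def addLast (r : Setoid (Fin k × Fin n)) : Setoid (Fin k × Fin (n + 1)) :=
  r.map inclPt ⊔ (⊤ : Setoid (Fin k)).map (lastPt n)

theorem inclPt_injective : Function.Injective (inclPt (k := k) (n := n)) := by
  rintro ⟨a, i⟩ ⟨b, j⟩ h
  simpa [inclPt] using h

theorem inclPt_ne_lastPt (p : Fin k × Fin n) (a : Fin k) : inclPt p ≠ lastPt n a := fun h =>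
  (Fin.castSucc_lt_last p.2).ne (congrArg Prod.snd h)

theorem pt_cases (p : Fin k × Fin (n + 1)) : (∃ q, inclPt q = p) ∨ ∃ a, lastPt n a = p := by
  rcases p with ⟨a, i⟩
  induction i using Fin.lastCases with
  | last => exact Or.inr ⟨a, rfl⟩
  | cast i => exact Or.inl ⟨(a, i), rfl⟩

theorem addLast_incl (r : Setoid (Fin k × Fin n)) (p q : Fin k × Fin n) :
    addLast r (inclPt p) (inclPt q) ↔ r p q := by
  have h : r.map inclPt (inclPt p) (inclPt q) ↔ r p q := by
    rw [← Setoid.comap_rel, Setoid.comap_map_eq _ _ inclPt_injective]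
  unfold addLast
  rw [sup_map_apply, h]
  refine ⟨?_, Or.inl⟩
  rintro (h | ⟨a, b, h1, -⟩)
  · exact h
  · rcases (map_apply inclPt_injective).1 h1 with h | ⟨c, d, -, -, h⟩
    · exact (inclPt_ne_lastPt _ _ h).elim
    · exact (inclPt_ne_lastPt _ _ h).elim

theorem addLast_last (r : Setoid (Fin k × Fin n)) (a b : Fin k) :
    addLast r (lastPt n a) (lastPt n b) :=
  map_le_iff.1 (le_sup_right : _ ≤ addLast r) trivial

theorem addLast_incl_last (r : Setoid (Fin k × Fin n)) (p : Fin k × Fin n) (b : Fin k) :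
    ¬ addLast r (inclPt p) (lastPt n b) := by
  unfold addLast
  rw [sup_map_apply]
  have key : ∀ b, ¬ r.map inclPt (inclPt p) (lastPt n b) := by
    intro b h
    rcases (map_apply inclPt_injective).1 h with h | ⟨c, d, -, -, h⟩
    · exact (inclPt_ne_lastPt _ _ h).elim
    · exact (inclPt_ne_lastPt _ _ h).elim
  rintro (h | ⟨a, b, h, -⟩)
  · exact key _ h
  · exact key _ h

/-- The tangle `E ∪ {{(0,n+1),(1,n+1)}}`. -/
def addStrand (E : FlatTangle n) : FlatTangle (n + 1) where
  rel := addLast E.rel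
  pairs := by
    rintro _ ⟨p, rfl⟩
    rcases pt_cases p with ⟨q, rfl⟩ | ⟨a, rfl⟩
    · refine Eq.trans ?_ (E.pairs _ (E.rel.mem_classes q))
      refine Eq.trans (congrArg Set.ncard ?_) (Set.ncard_image_of_injective _ inclPt_injective)
      ext x
      rcases pt_cases x with ⟨y, rfl⟩ | ⟨b, rfl⟩
      · rw [Function.Injective.mem_set_image inclPt_injective]
        exact addLast_incl _ _ _
      · refine ⟨fun h => (addLast_incl_last _ _ _ (Setoid.symm' _ h)).elim, ?_⟩
        rintro ⟨y, -, h⟩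
        exact (inclPt_ne_lastPt _ _ h).elim
    · rw [Set.ncard_eq_two]
      refine ⟨lastPt n 0, lastPt n 1, fun h => ?_, ?_⟩
      · exact zero_ne_one (congrArg Prod.fst h)
      · ext x
        rcases pt_cases x with ⟨y, rfl⟩ | ⟨b, rfl⟩
        · refine ⟨fun h => (addLast_incl_last _ _ _ h).elim, ?_⟩
          rintro (h | h) <;> exact (inclPt_ne_lastPt _ _ h).elim
        · refine ⟨fun _ => ?_, fun _ => addLast_last _ _ _⟩
          fin_cases b
          · exact Or.inl rfl
          · exact Or.inr rfl

theorem addStrand_injective : Function.Injective (addStrand (n := n)) := by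
  intro E E' h
  apply FlatTangle.ext
  ext p q
  have := congrArg FlatTangle.rel h
  change addLast E.rel = addLast E'.rel at this
  rw [← addLast_incl E.rel, this, addLast_incl]

theorem addStrand_id : addStrand (idTangle n) = idTangle (n + 1) := by
  apply FlatTangle.ext
  ext p q
  rw [idTangle_rel]
  change addLast (idTangle n).rel p q ↔ _
  rcases pt_cases p with ⟨p, rfl⟩ | ⟨a, rfl⟩ <;> rcases pt_cases q with ⟨q, rfl⟩ | ⟨b, rfl⟩
  · rw [addLast_incl, idTangle_rel]
    exact (Fin.castSucc_injective n).eq_iff.symm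
  · exact ⟨fun h => (addLast_incl_last _ _ _ h).elim,
      fun h => ((Fin.castSucc_lt_last p.2).ne h).elim⟩
  · exact ⟨fun h => (addLast_incl_last _ _ _ (Setoid.symm' _ h)).elim,
      fun h => ((Fin.castSucc_lt_last q.2).ne h.symm).elim⟩
  · exact ⟨fun _ => rfl, fun _ => addLast_last _ _ _⟩

theorem stack_addStrand (E E' : FlatTangle n) :
    stack (addStrand E) (addStrand E') = addLast (stack E E') := by
  apply le_antisymm
  · refine sup_le ?_ ?_ <;> rw [map_le_iff] <;> refine sup_le ?_ ?_ <;> rw [map_le_iff] <;>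
      intro p q h
    · exact (addLast_incl (stack E E') (firstPt p) (firstPt q)).2
        (map_le_iff.1 (le_sup_left : _ ≤ stack E E') h)
    · exact addLast_last _ _ _
    · exact (addLast_incl (stack E E') (secondPt p) (secondPt q)).2
        (map_le_iff.1 (le_sup_right : _ ≤ stack E E') h)
    · exact addLast_last _ _ _
  · have h1 := map_le_iff.1 (le_sup_left : _ ≤ stack (addStrand E) (addStrand E'))
    have h2 := map_le_iff.1 (le_sup_right : _ ≤ stack (addStrand E) (addStrand E'))
    refine sup_le ?_ ?_ <;> rw [map_le_iff]
    · refine sup_le ?_ ?_ <;> rw [map_le_iff] <;> intro p q h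
      · exact h1 ((addLast_incl E.rel p q).2 h)
      · exact h2 ((addLast_incl E'.rel p q).2 h)
    · have h3 : ∀ a : Fin 3, stack (addStrand E) (addStrand E') (lastPt n a) (lastPt n 1) := by
        intro a
        fin_cases a
        · exact h1 (addLast_last E.rel 0 1)
        · exact Setoid.refl' _ _
        · exact h2 (addLast_last E'.rel 1 0)
      intro a b _
      exact Setoid.trans' _ (h3 a) (Setoid.symm' _ (h3 b))

theorem outerPt_incl (p : Pt n) : outerPt (inclPt p) = inclPt (outerPt p) := rfl

theorem outerPt_last (a : Fin 2) : outerPt (lastPt n a) = lastPt n (![0, 2] a) := rfl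

theorem addStrand_concat (E E' : FlatTangle n) :
    concat (addStrand E) (addStrand E') = addStrand (concat E E') := by
  apply FlatTangle.ext
  ext p q
  change stack (addStrand E) (addStrand E') (outerPt p) (outerPt q) ↔
    addLast ((stack E E').comap outerPt) p q
  rw [stack_addStrand]
  rcases pt_cases p with ⟨p, rfl⟩ | ⟨a, rfl⟩ <;> rcases pt_cases q with ⟨q, rfl⟩ | ⟨b, rfl⟩
  · rw [outerPt_incl, outerPt_incl, addLast_incl, addLast_incl]
    exact Iff.rfl
  · rw [outerPt_incl, outerPt_last]
    exact ⟨fun h => (addLast_incl_last _ _ _ h).elim, fun h => (addLast_incl_last _ _ _ h).elim⟩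
  · rw [outerPt_incl, outerPt_last]
    exact ⟨fun h => (addLast_incl_last _ _ _ (Setoid.symm' _ h)).elim,
      fun h => (addLast_incl_last _ _ _ (Setoid.symm' _ h)).elim⟩
  · exact ⟨fun _ => addLast_last _ _ _, fun _ => addLast_last _ _ _⟩

theorem addStrand_loops (E E' : FlatTangle n) :
    loops (addStrand E) (addStrand E') = loops E E' := by
  unfold loops
  rw [stack_addStrand]
  unfold freeClasses
  symm
  refine Nat.card_congr (Equiv.ofBijective (fun c => ⟨Quotient.map' (s₂ := addLast (stack E E'))
    inclPt (fun a b h => (addLast_incl _ _ _).2 h) c.1, ?_⟩) ⟨?_, ?_⟩)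
  · rcases c with ⟨c, hc⟩
    induction c using Quotient.inductionOn with | _ x =>
    intro p h
    have h' := Quotient.exact h
    rcases pt_cases p with ⟨p, rfl⟩ | ⟨a, rfl⟩
    · exact hc p (Quotient.sound ((addLast_incl _ _ _).1 h'))
    · exact addLast_incl_last _ _ _ (Setoid.symm' _ h')
  · rintro ⟨c, hc⟩ ⟨d, hd⟩ h
    induction c using Quotient.inductionOn with | _ x =>
    induction d using Quotient.inductionOn with | _ y =>
    congr 1
    exact Quotient.sound ((addLast_incl _ _ _).1 (Quotient.exact (Subtype.ext_iff.1 h)))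
  · rintro ⟨c, hc⟩
    induction c using Quotient.inductionOn with | _ x =>
    rcases pt_cases x with ⟨y, rfl⟩ | ⟨b, rfl⟩
    · exact ⟨⟨Quotient.mk _ y, fun p h => hc (inclPt p)
        (Quotient.sound ((addLast_incl _ _ _).2 (Quotient.exact h)))⟩, rfl⟩
    · exact (hc (lastPt n 0) (Quotient.sound (addLast_last _ _ _))).elim

end Strand

section Algebra

variable (R : Type*) [CommRing R] (z : R) (n : ℕ)

/-- The virtual Temperley–Lieb algebra with loop value `z`: the free `R`-module on the flat virtual
`n`-tangles. -/
def VTL (_z : R) (n : ℕ) : Type _ := FlatTangle n →₀ R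

namespace VTL

noncomputable instance : AddCommGroup (VTL R z n) :=
  inferInstanceAs (AddCommGroup (FlatTangle n →₀ R))

noncomputable instance : Module R (VTL R z n) :=
  inferInstanceAs (Module R (FlatTangle n →₀ R))

variable {n}

/-- A flat virtual tangle as a basis element. -/
noncomputable def of (E : FlatTangle n) : VTL R z n := Finsupp.single E 1

variable {R z}

/-- The linear extension of a map defined on flat virtual tangles. -/
noncomputable def lift {M : Type*} [AddCommGroup M] [Module R M] (φ : FlatTangle n → M) :
    VTL R z n →ₗ[R] M :=
  Finsupp.linearCombination R φ

@[simp]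
theorem lift_of {M : Type*} [AddCommGroup M] [Module R M] (φ : FlatTangle n → M)
    (E : FlatTangle n) : lift φ (of R z E) = φ E := by
  exact (Finsupp.linearCombination_single R 1 E).trans (one_smul R _)

theorem hom_ext {M : Type*} [AddCommGroup M] [Module R M] {f g : VTL R z n →ₗ[R] M}
    (h : ∀ E, f (of R z E) = g (of R z E)) : f = g :=
  Finsupp.lhom_ext' fun E => LinearMap.ext_ring (h E)

variable (R z) in
/-- The bilinear multiplication given by `E E' = z ^ m (E * E')`, where `m` is the number of closed
curves in the concatenation of `E` and `E'`. -/
noncomputable def mulHom : VTL R z n →ₗ[R] VTL R z n →ₗ[R] VTL R z n :=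
  lift fun E => lift fun E' => z ^ loops E E' • of R z (concat E E')

noncomputable instance : Mul (VTL R z n) := ⟨fun x y => mulHom R z x y⟩

noncomputable instance : One (VTL R z n) := ⟨of R z (idTangle n)⟩

theorem mul_def (x y : VTL R z n) : x * y = mulHom R z x y := rfl

theorem one_def : (1 : VTL R z n) = of R z (idTangle n) := rfl

theorem of_mul_of (E E' : FlatTangle n) :
    of R z E * of R z E' = z ^ loops E E' • of R z (concat E E') := by
  rw [mul_def, mulHom, lift_of, lift_of]

protected theorem one_mul (x : VTL R z n) : 1 * x = x := by
  have : mulHom R z (1 : VTL R z n) = LinearMap.id := hom_ext fun E => by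
    rw [← mul_def, one_def, of_mul_of, (id_concat_aux E).1, (id_concat_aux E).2, pow_zero,
      one_smul, LinearMap.id_apply]
  rw [mul_def, this, LinearMap.id_apply]

protected theorem mul_one (x : VTL R z n) : x * 1 = x := by
  have : (mulHom R z).flip (1 : VTL R z n) = LinearMap.id := hom_ext fun E => by
    rw [LinearMap.flip_apply, ← mul_def, one_def, of_mul_of, (concat_id_aux E).1,
      (concat_id_aux E).2, pow_zero, one_smul, LinearMap.id_apply]
  rw [mul_def, ← LinearMap.flip_apply, this, LinearMap.id_apply]

theorem induction {p : VTL R z n → Prop} (x : VTL R z n) (hof : ∀ E, p (of R z E))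
    (hadd : ∀ x y, p x → p y → p (x + y)) (hsmul : ∀ (a : R) x, p x → p (a • x)) : p x := by
  refine Finsupp.induction_linear x ?_ hadd ?_
  · have := hsmul 0 _ (hof (idTangle n))
    rwa [zero_smul] at this
  · intro E a
    have := hsmul a _ (hof E)
    have h : a • of R z E = Finsupp.single E a :=
      (Finsupp.smul_single a E (1 : R)).trans (by rw [smul_eq_mul, _root_.mul_one])
    rwa [h] at this

protected theorem add_mul (x y w : VTL R z n) : (x + y) * w = x * w + y * w := by
  simp only [mul_def, map_add, LinearMap.add_apply]

protected theorem mul_add (x y w : VTL R z n) : x * (y + w) = x * y + x * w := by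
  simp only [mul_def, map_add]

protected theorem smul_mul (a : R) (x y : VTL R z n) : (a • x) * y = a • (x * y) := by
  simp only [mul_def, map_smul, LinearMap.smul_apply]

protected theorem mul_smul (a : R) (x y : VTL R z n) : x * (a • y) = a • (x * y) := by
  simp only [mul_def, map_smul]

protected theorem mul_assoc (x y w : VTL R z n) : x * y * w = x * (y * w) := by
  induction x using VTL.induction with
  | hadd x x' h h' => simp only [VTL.add_mul, h, h']
  | hsmul a x h => simp only [VTL.smul_mul, h]
  | hof E =>
    induction y using VTL.induction with
    | hadd x x' h h' => simp only [VTL.add_mul, VTL.mul_add, h, h']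
    | hsmul a x h => simp only [VTL.smul_mul, VTL.mul_smul, h]
    | hof E' =>
      induction w using VTL.induction with
      | hadd x x' h h' => simp only [VTL.mul_add, h, h']
      | hsmul a x h => simp only [VTL.mul_smul, h]
      | hof E'' =>
        have h := concat_assoc_aux E E' E''
        simp only [of_mul_of, VTL.smul_mul, VTL.mul_smul, smul_smul, ← pow_add]
        rw [h.1, h.2]

noncomputable instance : Ring (VTL R z n) :=
  { (inferInstance : AddCommGroup (VTL R z n)) with
    mul := (· * ·)
    one := 1
    one_mul := VTL.one_mul
    mul_one := VTL.mul_one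
    mul_assoc := VTL.mul_assoc
    left_distrib := VTL.mul_add
    right_distrib := VTL.add_mul
    zero_mul := fun x => by rw [mul_def, map_zero, LinearMap.zero_apply]
    mul_zero := fun x => by rw [mul_def, map_zero] }

noncomputable instance : Algebra R (VTL R z n) :=
  Algebra.ofModule VTL.smul_mul VTL.mul_smul

variable (R z n) in
/-- The inclusion `VTL_n → VTL_{n+1}`, which sends `E` to `E ∪ {{(0,n+1),(1,n+1)}}`. -/
noncomputable def incl : VTL R z n →ₐ[R] VTL R z (n + 1) :=
  AlgHom.ofLinearMap (lift fun E => of R z (addStrand E))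
    (by rw [one_def, lift_of, addStrand_id, one_def])
    (by
      intro x y
      induction x using VTL.induction with
      | hadd x x' h h' => simp only [add_mul, map_add, h, h']
      | hsmul a x h => simp only [smul_mul_assoc, map_smul, h]
      | hof E =>
        induction y using VTL.induction with
        | hadd x x' h h' => simp only [mul_add, map_add, h, h']
        | hsmul a x h => simp only [mul_smul_comm, map_smul, h]
        | hof E' =>
          rw [of_mul_of, map_smul, lift_of, lift_of, lift_of, of_mul_of, addStrand_concat,
            addStrand_loops])

theorem incl_injective : Function.Injective (incl R z n) := by
  have h : ⇑(incl R z n) = fun x : FlatTangle n →₀ R => Finsupp.mapDomain addStrand x := by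
    have h' : (incl R z n).toLinearMap = Finsupp.lmapDomain R R addStrand :=
      hom_ext fun E => (lift_of _ _).trans (Finsupp.mapDomain_single).symm
    exact congrArg DFunLike.coe h'
  rw [h]
  exact Finsupp.mapDomain_injective addStrand_injective

end VTL

end Algebra

section Generators

variable {n : ℕ}

theorem swap_ne (i : Fin n) {j : Fin (n + 1)} (hj : j = i.castSucc ∨ j = i.succ) :
    Equiv.swap i.castSucc i.succ j ≠ j := by
  have : i.castSucc ≠ i.succ := Fin.castSucc_lt_succ.ne
  rcases hj with rfl | rfl
  · rw [Equiv.swap_apply_left]; exact this.symm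
  · rw [Equiv.swap_apply_right]; exact this

theorem swap_mem (i : Fin n) (j : Fin (n + 1)) :
    (Equiv.swap i.castSucc i.succ j = i.castSucc ∨ Equiv.swap i.castSucc i.succ j = i.succ) ↔
      (j = i.castSucc ∨ j = i.succ) := by
  rw [Equiv.swap_apply_eq_iff, Equiv.swap_apply_eq_iff, Equiv.swap_apply_left,
    Equiv.swap_apply_right, or_comm]

/-- The tangle `v_i` on `n + 1` strands: the strands `i` and `i + 1` cross, that is, its pairs are
`{(0,i),(1,i+1)}`, `{(0,i+1),(1,i)}` and `{(0,j),(1,j)}` for `j ≠ i, i + 1`. -/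
def vTangle (i : Fin n) : FlatTangle (n + 1) :=
  FlatTangle.ofInvolution (fun p => (p.1.rev, Equiv.swap i.castSucc i.succ p.2))
    (fun p => by simp)
    (fun p h => by
      have : ∀ a : Fin 2, a.rev ≠ a := by decide
      exact this p.1 (congrArg Prod.fst h))

/-- The tangle `E_i` on `n + 1` strands: its pairs are `{(0,i),(0,i+1)}`, `{(1,i),(1,i+1)}` and
`{(0,j),(1,j)}` for `j ≠ i, i + 1`. -/
def eTangle (i : Fin n) : FlatTangle (n + 1) :=
  FlatTangle.ofInvolution
    (fun p => (if p.2 = i.castSucc ∨ p.2 = i.succ then p.1 else p.1.rev,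
      Equiv.swap i.castSucc i.succ p.2))
    (fun p => by
      simp only [swap_mem, Equiv.swap_apply_self]
      split_ifs <;> simp)
    (fun p h => by
      have : ∀ a : Fin 2, a.rev ≠ a := by decide
      by_cases hp : p.2 = i.castSucc ∨ p.2 = i.succ
      · exact swap_ne i hp (congrArg Prod.snd h)
      · have h' := congrArg Prod.fst h
        simp only [if_neg hp] at h'
        exact this p.1 h')

/-- The map that identifies the points of `{0,…,k} × {1,…,n+1}` along the classes of a stack of
copies of `E_i`. -/
def eCollapse {k : ℕ} (i : Fin n) (p : Fin (k + 1) × Fin (n + 1)) :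
    Fin (k + 1) × Fin (n + 1) :=
  if p.2 = i.castSucc ∨ p.2 = i.succ then (p.1, i.castSucc) else (0, p.2)

theorem eTangle_rel (i : Fin n) : (eTangle i).rel = Setoid.ker (eCollapse i) := by
  have hr : ∀ a b : Fin 2, b = a ∨ b = a.rev := by decide
  apply le_antisymm
  · rintro p q (h | h)
    · rw [h]
    · rw [Setoid.ker_def, h]
      by_cases hp : p.2 = i.castSucc ∨ p.2 = i.succ
      · simp only [eCollapse, swap_mem, if_pos hp]
      · have hp' := hp
        rw [not_or] at hp'
        simp only [eCollapse, if_neg hp, Equiv.swap_apply_of_ne_of_ne hp'.1 hp'.2]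
  · have key : ∀ p : Pt (n + 1), (eTangle i).rel p (eCollapse i p) := by
      intro p
      by_cases hp : p.2 = i.castSucc ∨ p.2 = i.succ
      · rw [eCollapse, if_pos hp]
        rcases hp with hp | hp
        · exact Or.inl (Prod.ext rfl hp.symm)
        · refine Or.inr (Prod.ext ?_ ?_)
          · simp only [hp, or_true, if_true]
          · simp only [hp, Equiv.swap_apply_right]
      · rw [eCollapse, if_neg hp]
        rcases hr p.1 0 with h | h
        · exact Or.inl (Prod.ext h rfl)
        · rw [not_or] at hp
          refine Or.inr (Prod.ext ?_ ?_)
          · simp only [hp, or_self, if_false, h]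
          · exact (Equiv.swap_apply_of_ne_of_ne hp.1 hp.2).symm
    intro p q h
    have h' : eCollapse i p = eCollapse i q := h
    exact Setoid.trans' _ (key p) (h' ▸ Setoid.symm' _ (key q))

theorem eCollapse_eq_iff {k : ℕ} (i : Fin n) (a b : Fin (k + 1)) (j j' : Fin (n + 1)) :
    eCollapse i (a, j) = eCollapse i (b, j') ↔
      ((j = i.castSucc ∨ j = i.succ) ∧ (j' = i.castSucc ∨ j' = i.succ) ∧ a = b) ∨
        (¬ (j = i.castSucc ∨ j = i.succ) ∧ j = j') := by
  unfold eCollapse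
  by_cases hj : j = i.castSucc ∨ j = i.succ <;> by_cases hj' : j' = i.castSucc ∨ j' = i.succ <;>
    simp only [hj, hj', if_true, if_false, Prod.mk.injEq] <;> grind

theorem stack_eTangle (i : Fin n) : stack (eTangle i) (eTangle i) = Setoid.ker (eCollapse i) := by
  apply le_antisymm
  · refine sup_le ?_ ?_ <;> rw [map_le_iff, eTangle_rel] <;> rintro ⟨a, j⟩ ⟨b, j'⟩ h
    · have h' := (eCollapse_eq_iff i a b j j').1 h
      refine (eCollapse_eq_iff i a.castSucc b.castSucc j j').2 (h'.imp ?_ id)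
      exact fun h => ⟨h.1, h.2.1, congrArg _ h.2.2⟩
    · have h' := (eCollapse_eq_iff i a b j j').1 h
      refine (eCollapse_eq_iff i a.succ b.succ j j').2 (h'.imp ?_ id)
      exact fun h => ⟨h.1, h.2.1, congrArg _ h.2.2⟩
  · have h1 : ∀ p q, eCollapse i p = eCollapse i q →
        stack (eTangle i) (eTangle i) (firstPt p) (firstPt q) := fun p q h =>
      map_le_iff.1 (le_sup_left : _ ≤ stack (eTangle i) (eTangle i)) (by rw [eTangle_rel]; exact h)
    have h2 : ∀ p q, eCollapse i p = eCollapse i q →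
        stack (eTangle i) (eTangle i) (secondPt p) (secondPt q) := fun p q h =>
      map_le_iff.1 (le_sup_right : _ ≤ stack (eTangle i) (eTangle i)) (by rw [eTangle_rel]; exact h)
    have key1 : ∀ (a : Fin 3) (j j' : Fin (n + 1)), (j = i.castSucc ∨ j = i.succ) →
        (j' = i.castSucc ∨ j' = i.succ) → stack (eTangle i) (eTangle i) (a, j) (a, j') := by
      intro a j j' hj hj'
      have hb : ∀ b : Fin 2, eCollapse i (b, j) = eCollapse i (b, j') := fun b =>
        (eCollapse_eq_iff i b b j j').2 (Or.inl ⟨hj, hj', rfl⟩)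
      fin_cases a
      · exact h1 _ _ (hb 0)
      · exact h1 _ _ (hb 1)
      · exact h2 _ _ (hb 1)
    have key2 : ∀ (a : Fin 3) (j : Fin (n + 1)), ¬ (j = i.castSucc ∨ j = i.succ) →
        stack (eTangle i) (eTangle i) (a, j) (1, j) := by
      intro a j hj
      have hb : ∀ b c : Fin 2, eCollapse i (b, j) = eCollapse i (c, j) := fun b c =>
        (eCollapse_eq_iff i b c j j).2 (Or.inr ⟨hj, rfl⟩)
      fin_cases a
      · exact h1 _ _ (hb 0 1)
      · exact Setoid.refl' _ _
      · exact h2 _ _ (hb 1 0)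
    rintro ⟨a, j⟩ ⟨b, j'⟩ h
    rcases (eCollapse_eq_iff i a b j j').1 h with ⟨hj, hj', rfl⟩ | ⟨hj, rfl⟩
    · exact key1 a j j' hj hj'
    · exact Setoid.trans' _ (key2 a j hj) (Setoid.symm' _ (key2 b j hj))

theorem concat_eTangle (i : Fin n) : concat (eTangle i) (eTangle i) = eTangle i := by
  apply FlatTangle.ext
  change (stack (eTangle i) (eTangle i)).comap outerPt = _
  rw [stack_eTangle, eTangle_rel]
  ext ⟨a, j⟩ ⟨b, j'⟩
  have : ∀ a b : Fin 2, (![0, 2] a : Fin 3) = ![0, 2] b ↔ a = b := by decide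
  change eCollapse i (![0, 2] a, j) = eCollapse i (![0, 2] b, j') ↔
    eCollapse i (a, j) = eCollapse i (b, j')
  rw [eCollapse_eq_iff, eCollapse_eq_iff, this]

theorem loops_eTangle (i : Fin n) : loops (eTangle i) (eTangle i) = 1 := by
  unfold loops freeClasses
  rw [stack_eTangle, Nat.card_eq_one_iff_unique]
  have hz : ∀ a : Fin 2, (![0, 2] a : Fin 3) ≠ 1 := by decide
  have h012 : ∀ a : Fin 3, a = 1 ∨ ∃ b : Fin 2, ![0, 2] b = a := by decide
  have key : ∀ p : Fin 3 × Fin (n + 1),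
      (∀ b, Quotient.mk (Setoid.ker (eCollapse i)) (outerPt b) ≠ Quotient.mk _ p) →
        eCollapse i p = eCollapse i (1, i.castSucc) := by
    rintro ⟨a, j⟩ h
    by_cases hj : j = i.castSucc ∨ j = i.succ
    · rcases h012 a with rfl | ⟨b, rfl⟩
      · exact (eCollapse_eq_iff i _ _ _ _).2 (Or.inl ⟨hj, Or.inl rfl, rfl⟩)
      · exact (h (b, j) rfl).elim
    · exact (h (0, j) (Quotient.sound
        ((eCollapse_eq_iff i (![0, 2] (0 : Fin 2)) a j j).2 (Or.inr ⟨hj, rfl⟩)))).elim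
  constructor
  · constructor
    rintro ⟨c, hc⟩ ⟨d, hd⟩
    induction c using Quotient.inductionOn with | _ x =>
    induction d using Quotient.inductionOn with | _ y =>
    congr 1
    exact Quotient.sound ((key x hc).trans (key y hd).symm)
  · refine ⟨⟨Quotient.mk _ (1, i.castSucc), fun b h => ?_⟩⟩
    rcases (eCollapse_eq_iff i (![0, 2] b.1) 1 b.2 i.castSucc).1 (Quotient.exact h) with h | h
    · exact hz _ h.2.2
    · exact h.1 (Or.inl h.2)

/-- The number of closed curves in the closure of `E`: the components obtained when `(0,i)` is
connected with `(1,i)` for all `i`. -/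
noncomputable def closedCurves (E : FlatTangle n) : ℕ :=
  Nat.card (Quotient (E.rel ⊔ Setoid.ker Prod.snd))

end Generators

/-- A sequence of linear forms on a tower of algebras `A 1 ⊆ A 2 ⊆ ⋯`, with inclusions `ι`, is a
Markov trace with respect to the images `S_1, …, S_n` and `v_1, …, v_n` in `A (n + 1)` of the
generators of the virtual braid group on `n + 1` strands. Here `S_{i+1}` and `v_{i+1}` are `S n i`
and `v n i` for `i : Fin n`. -/
structure IsMarkovTrace {R : Type*} [CommRing R] (A : ℕ → Type*) [∀ n, Ring (A n)]
    [∀ n, Algebra R (A n)] (ι : ∀ n, A n →ₐ[R] A (n + 1)) (S : ∀ n, Fin n → (A (n + 1))ˣ)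
    (v : ∀ n, Fin n → A (n + 1)) (T : ∀ n, A n →ₗ[R] R) : Prop where
  /-- `T_n (x y) = T_n (y x)` for `n ≥ 1` -/
  trace : ∀ n, 1 ≤ n → ∀ x y : A n, T n (x * y) = T n (y * x)
  /-- `T_n (x) = T_{n+1} (x S_n)` for `n ≥ 1` -/
  stab_S : ∀ m, ∀ x : A (m + 1),
    T (m + 1) x = T (m + 2) (ι (m + 1) x * S (m + 1) (Fin.last m))
  /-- `T_n (x) = T_{n+1} (x S_n⁻¹)` for `n ≥ 1` -/
  stab_S_inv : ∀ m, ∀ x : A (m + 1),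
    T (m + 1) x = T (m + 2) (ι (m + 1) x * ↑(S (m + 1) (Fin.last m))⁻¹)
  /-- `T_n (x) = T_{n+1} (x v_n)` for `n ≥ 1` -/
  stab_v : ∀ m, ∀ x : A (m + 1),
    T (m + 1) x = T (m + 2) (ι (m + 1) x * v (m + 1) (Fin.last m))
  /-- `T_n (x) = T_{n+1} (x S_n⁻¹ v_{n-1} S_n)` for `n ≥ 2` -/
  stab_right : ∀ m, ∀ x : A (m + 2),
    T (m + 2) x = T (m + 3) (ι (m + 2) x * ↑(S (m + 2) (Fin.last (m + 1)))⁻¹ *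
      v (m + 2) (Fin.last m).castSucc * S (m + 2) (Fin.last (m + 1)))
  /-- `T_n (x) = T_{n+1} (x v_n v_{n-1} S_{n-1} v_n S_{n-1}⁻¹ v_{n-1} v_n)` for `n ≥ 2` -/
  stab_left : ∀ m, ∀ x : A (m + 2),
    T (m + 2) x = T (m + 3) (ι (m + 2) x * v (m + 2) (Fin.last (m + 1)) *
      v (m + 2) (Fin.last m).castSucc * S (m + 2) (Fin.last m).castSucc *
      v (m + 2) (Fin.last (m + 1)) * ↑(S (m + 2) (Fin.last m).castSucc)⁻¹ *
      v (m + 2) (Fin.last m).castSucc * v (m + 2) (Fin.last (m + 1)))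

section Laurent

open LaurentPolynomial

/-- The loop value `z = -A² - A⁻²` in `ℤ[A, A⁻¹]`, where `A ^ k` is `T k`. -/
noncomputable def loopValue : ℤ[T;T⁻¹] := -T 2 - T (-2)

/-- The virtual Temperley–Lieb algebra over `ℤ[A, A⁻¹]`. -/
abbrev VTLf (n : ℕ) : Type := VTL ℤ[T;T⁻¹] loopValue n

/-- The generator `E_{i+1}` of the algebra on `n + 1` strands. -/
noncomputable def eGen (n : ℕ) (i : Fin n) : VTLf (n + 1) := VTL.of _ _ (eTangle i)

/-- The generator `v_{i+1}` of the algebra on `n + 1` strands. -/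
noncomputable def vGen (n : ℕ) (i : Fin n) : VTLf (n + 1) := VTL.of _ _ (vTangle i)

theorem eGen_mul_eGen (n : ℕ) (i : Fin n) : eGen n i * eGen n i = loopValue • eGen n i := by
  rw [eGen, VTL.of_mul_of, concat_eTangle, loops_eTangle, pow_one]

theorem sGen_aux (n : ℕ) (i : Fin n) (k : ℤ) (hk : k = 2 ∨ k = -2) :
    (-(T k : ℤ[T;T⁻¹]) • (1 : VTLf (n + 1)) - (T (2 * k) : ℤ[T;T⁻¹]) • eGen n i) *
      (-(T (-k) : ℤ[T;T⁻¹]) • (1 : VTLf (n + 1)) - (T (-(2 * k)) : ℤ[T;T⁻¹]) • eGen n i) = 1 := by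
  have hz : loopValue = -T k - T (-k) := by
    rcases hk with rfl | rfl
    · rfl
    · rw [loopValue, neg_neg]; ring
  have h0 : (T k * T (-k) : ℤ[T;T⁻¹]) = 1 := by rw [← T_add, add_neg_cancel, T_zero]
  have h1 : (T (2 * k) * T (-(2 * k)) : ℤ[T;T⁻¹]) = 1 := by rw [← T_add, add_neg_cancel, T_zero]
  have h2 : (T k * T (-(2 * k)) : ℤ[T;T⁻¹]) = T (-k) := by rw [← T_add]; congr 1; ring
  have h3 : (T (2 * k) * T (-k) : ℤ[T;T⁻¹]) = T k := by rw [← T_add]; congr 1; ring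
  simp only [sub_mul, mul_sub, smul_mul_smul_comm, one_mul, mul_one, eGen_mul_eGen,
    neg_mul, mul_neg, h0, h1, h2, h3, hz, neg_smul, sub_smul, one_smul]
  abel

/-- The element `S_{i+1} = -A⁻² - A⁻⁴ E_{i+1}` of the algebra on `n + 1` strands, as a unit. -/
noncomputable def sGen (n : ℕ) (i : Fin n) : (VTLf (n + 1))ˣ where
  val := -(T (-2) : ℤ[T;T⁻¹]) • (1 : VTLf (n + 1)) - (T (-4) : ℤ[T;T⁻¹]) • eGen n i
  inv := -(T 2 : ℤ[T;T⁻¹]) • (1 : VTLf (n + 1)) - (T 4 : ℤ[T;T⁻¹]) • eGen n i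
  val_inv := sGen_aux n i (-2) (Or.inr rfl)
  inv_val := sGen_aux n i 2 (Or.inl rfl)

/-- The inclusions of the tower. -/
noncomputable def inclf (n : ℕ) : VTLf n →ₐ[ℤ[T;T⁻¹]] VTLf (n + 1) := VTL.incl _ _ n

/-- The linear form with value `z ^ t(E)` at a flat virtual tangle `E` whose closure consists of
`t(E)` closed curves. -/
noncomputable def traceForm (n : ℕ) : VTLf n →ₗ[ℤ[T;T⁻¹]] ℤ[T;T⁻¹] :=
  VTL.lift fun E => loopValue ^ closedCurves E

end Laurent

end VirtualTL

namespace VirtualTL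

/-! ### Counting components -/

section Counting

variable {X Y : Type*}

/-! Every exponent of `loopValue` that occurs is a number of components of a graph, that is, a
number of classes of a join of equivalence relations. Such a number does not change when points that
are already related are glued together (`card_quotient_map`), so each geometric statement about
closures becomes a choice of gluing map.

Trace property: closing up the concatenation of `E` and `E'` turns its inner loops and the closure
of its arcs into one family of curves, and these curves are the components of `E` glued to the
reflection of `E'` (`loops_add_closedCurves`). Reflecting everything exchanges the two tangles, so
`T (E E') = T (E' E)`.

Stabilization: adding a free strand creates one more closed curve, whence `T (ι x) = z T x`. When
the added strand is followed by `E_n` or `v_n`, folding it onto the previous strand closes that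
strand up (`card_quotient_fold`), whence `T (ι x E_n) = T (ι x v_n) = T x`. The rules for `S_n` and
its inverse then reduce to `-A^(∓2) z - A^(∓4) = 1`, which is what the value of `z` provides.

The last two moves need three strands. Write `u = v_{n-1}`, `w = v_n`, `e = E_{n-1}`, `f = E_n`.
Expanding gives `S_n⁻¹ u S_n = u + A⁻² u f + A² f u + f u f`, and `f u f = f` by
`eGen_mul_vGen_mul_eGen`. After multiplication by `x`, the first three terms have total trace `(z +
A² + A⁻²) T (x u) = 0` and the last one gives `T x`. For the other move, the braid relation and `w e
w = u f u` turn the conjugated word into `u + A² f u + A⁻² u f + u f u`. The same cancellation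
occurs, and the last term gives `T (u x u) = T x` because `u² = 1`. -/

theorem card_quotient_map {r : Setoid X} {q : X → Y} (hq : Function.Surjective q)
    (hr : Setoid.ker q ≤ r) : Nat.card (Quotient (r.map q)) = Nat.card (Quotient r) := by
  symm
  have hrel : ∀ x y, r.map q (q x) (q y) → r x y := by
    intro x y h
    have h' : (r.map q : Y → Y → Prop) (q x) (q y) := h
    rw [Setoid.coe_map_of_ker_le r q hr] at h'
    rcases h' with ⟨a, b, hab, ha, hb⟩ | h'
    · exact r.trans' (hr ha.symm) (r.trans' hab (hr hb))
    · exact hr h'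
  refine Nat.card_congr (Equiv.ofBijective
    (Quotient.map' (s₂ := r.map q) q fun a b h => (Setoid.le_comap_map h : _)) ⟨?_, ?_⟩)
  · intro c d h
    induction c using Quotient.inductionOn with | _ x =>
    induction d using Quotient.inductionOn with | _ y =>
    exact Quotient.sound (hrel x y (Quotient.exact h))
  · intro c
    induction c using Quotient.inductionOn with | _ y =>
    obtain ⟨x, rfl⟩ := hq y
    exact ⟨Quotient.mk _ x, rfl⟩

/-- With no marked points every class is free. This lets `freeClasses_sup_map` count all classes of
a join. -/
theorem freeClasses_empty (r : Setoid X) (f : Empty → X) :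
    freeClasses r f = Nat.card (Quotient r) :=
  Nat.card_congr (Equiv.subtypeUnivEquiv fun _ b => b.elim)

end Counting

/-! ### The closure of a product as a symmetric pairing -/

section Pairing

variable {n : ℕ}

/-- The reflection of the end points that exchanges the two levels. -/
def flipPt (p : Pt n) : Pt n := (p.1.rev, p.2)

theorem flipPt_involutive : Function.Involutive (flipPt (n := n)) := fun p => by
  simp [flipPt]

/-- The identification of the level `2` of a concatenation with the level `0`. -/
def closePt (p : Fin 3 × Fin n) : Pt n := (![0, 1, 0] p.1, p.2)

/-- Adding the closing arcs at the outer points of a concatenation is the same as gluing level `2`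
to level `0`. Only the outer levels are identified, since `closePt` keeps level `1` apart. -/
theorem ker_closePt : Setoid.ker (closePt (n := n)) = (Setoid.ker Prod.snd).map outerPt := by
  apply le_antisymm
  · rintro ⟨a, i⟩ ⟨b, j⟩ h
    have h1 : (![0, 1, 0] a : Fin 2) = ![0, 1, 0] b := congrArg Prod.fst h
    obtain rfl : i = j := congrArg Prod.snd h
    rw [map_apply outerPt_injective]
    have : ∀ a b : Fin 3, (![0, 1, 0] a : Fin 2) = ![0, 1, 0] b →
        a = b ∨ ∃ c d : Fin 2, ![0, 2] c = a ∧ ![0, 2] d = b := by decide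
    rcases this a b h1 with rfl | ⟨c, d, rfl, rfl⟩
    · exact Or.inl rfl
    · exact Or.inr ⟨(c, i), (d, i), rfl, rfl, rfl⟩
  · rw [map_le_iff]
    rintro ⟨a, i⟩ ⟨b, j⟩ h
    obtain rfl : i = j := h
    have : ∀ a : Fin 2, (![0, 1, 0] (![0, 2] a : Fin 3) : Fin 2) = 0 := by decide
    exact Prod.ext ((this a).trans (this b).symm) rfl

/-- The closure of a concatenation consists of the components of the first diagram glued to the
reflection of the second one. -/
theorem loops_add_closedCurves (E E' : FlatTangle n) :
    loops E E' + closedCurves (concat E E') =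
      Nat.card (Quotient (E.rel ⊔ E'.rel.map flipPt)) := by
  -- A component of the closed-up stack either avoids the outer points, and is then an inner loop,
  -- or comes from a component of the closure of `concat E E'`.
  have h := freeClasses_sup_map (stack E E') outerPt (Setoid.ker Prod.snd)
    (Empty.elim : Empty → Pt n)
  rw [freeClasses_empty, freeClasses_empty, ← ker_closePt] at h
  have hs : Function.Surjective (closePt (n := n)) := by
    rintro ⟨a, i⟩
    exact ⟨(a.castSucc, i), by fin_cases a <;> rfl⟩
  refine h.symm.trans ?_
  -- Perform the gluing: after `closePt` the closing arcs become trivial, the first diagram stays in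
  -- place and the second one appears with its levels exchanged.
  rw [← card_quotient_map hs le_sup_right]
  have h1 : (Setoid.ker (closePt (n := n))).map closePt = ⊥ := by
    rw [eq_bot_iff, map_le_iff]
    exact fun _ _ h => h
  have h2 : closePt ∘ firstPt (n := n) = id := by
    apply level_ext; intro a i; fin_cases a <;> rfl
  have h3 : closePt ∘ secondPt (n := n) = flipPt := by
    apply level_ext; intro a i; fin_cases a <;> rfl
  have h4 : E.rel.map id = E.rel := le_antisymm (map_le_iff.2 le_rfl) Setoid.le_comap_map
  rw [map_sup, h1, sup_bot_eq, stack, map_sup, map_map, map_map, h2, h3, h4]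

/-- The relation `E.rel ⊔ E'.rel.map flipPt` is carried by the bijection `flipPt` to the one with
`E` and `E'` exchanged. This is the trace property on basis elements. -/
theorem loops_add_closedCurves_comm (E E' : FlatTangle n) :
    loops E E' + closedCurves (concat E E') = loops E' E + closedCurves (concat E' E) := by
  rw [loops_add_closedCurves, loops_add_closedCurves,
    ← card_quotient_map flipPt_involutive.surjective
      ((Setoid.ker_eq_bot_iff.2 flipPt_involutive.injective).trans_le bot_le)]
  have h : E'.rel.map (flipPt ∘ flipPt) = E'.rel := by
    rw [flipPt_involutive.comp_self]
    exact le_antisymm (map_le_iff.2 le_rfl) Setoid.le_comap_map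
  rw [map_sup, map_map, h, sup_comm]

end Pairing

/-! ### Closures after adding a strand -/

section Stabilization

variable {k n : ℕ}

theorem card_quotient_addLast (r : Setoid (Fin (k + 1) × Fin n)) :
    Nat.card (Quotient (addLast r)) = Nat.card (Quotient r) + 1 := by
  rw [← Finite.card_option]
  symm
  refine Nat.card_congr (Equiv.ofBijective (fun c => c.elim (Quotient.mk _ (lastPt n 0))
    (Quotient.map' (s₂ := addLast r) inclPt fun a b h => (addLast_incl _ _ _).2 h)) ⟨?_, ?_⟩)
  · rintro (_ | c) (_ | d) h
    · rfl
    · induction d using Quotient.inductionOn with | _ y =>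
      exact (addLast_incl_last _ _ _ (Setoid.symm' _ (Quotient.exact h))).elim
    · induction c using Quotient.inductionOn with | _ x =>
      exact (addLast_incl_last _ _ _ (Quotient.exact h)).elim
    · induction c using Quotient.inductionOn with | _ x =>
      induction d using Quotient.inductionOn with | _ y =>
      exact congrArg some (Quotient.sound ((addLast_incl _ _ _).1 (Quotient.exact h)))
  · intro c
    induction c using Quotient.inductionOn with | _ x =>
    rcases pt_cases x with ⟨y, rfl⟩ | ⟨b, rfl⟩
    · exact ⟨some (Quotient.mk _ y), rfl⟩
    · exact ⟨none, Quotient.sound (addLast_last _ _ _)⟩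

/-- The new strand meets none of the others and closes up to a circle of its own, so the closure
relation is `addLast` of the old one. -/
theorem closedCurves_addStrand (E : FlatTangle n) :
    closedCurves (addStrand E) = closedCurves E + 1 := by
  rw [closedCurves, closedCurves, ← card_quotient_addLast]
  congr 2
  apply le_antisymm
  · refine sup_le (sup_le ?_ le_sup_right) ?_
    · rw [map_le_iff]
      exact fun p q h => (addLast_incl _ p q).2 ((le_sup_left : E.rel ≤ _) h)
    · intro p q h
      rcases pt_cases p with ⟨p, rfl⟩ | ⟨a, rfl⟩ <;> rcases pt_cases q with ⟨q, rfl⟩ | ⟨b, rfl⟩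
      · exact (addLast_incl _ p q).2 ((le_sup_right : Setoid.ker Prod.snd ≤ _)
          (Fin.castSucc_injective n h))
      · exact ((Fin.castSucc_lt_last p.2).ne h).elim
      · exact ((Fin.castSucc_lt_last q.2).ne h.symm).elim
      · exact addLast_last _ _ _
  · refine sup_le ?_ ?_ <;> rw [map_le_iff]
    · refine sup_le (map_le_iff.1 (le_sup_left.trans le_sup_left)) ?_
      exact fun p q h => (le_sup_right : Setoid.ker Prod.snd ≤ _) (congrArg Fin.castSucc h)
    · exact fun a b _ => (le_sup_right : Setoid.ker Prod.snd ≤ _) rfl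

/-- Folding the last strand onto the previous one closes that strand up, when the last strand is
glued to it through `ρ`. -/
theorem card_quotient_fold (E : FlatTangle (n + 1)) (s : Setoid (Pt (n + 2))) (ρ : Fin 2 → Fin 2)
    (hρ : Function.Injective ρ)
    (hs : ∀ a, s (a, Fin.last (n + 1)) (ρ a, (Fin.last n).castSucc))
    (hs' : ∀ a (i : Fin n), s (a, i.castSucc.castSucc) (a.rev, i.castSucc.castSucc))
    (hs'' : s ≤ Setoid.ker fun p : Pt (n + 2) =>
      (Fin.lastCases (Fin.last n) id p.2 : Fin (n + 1))) :
    Nat.card (Quotient ((addStrand E).rel ⊔ s)) = closedCurves E := by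
  -- The fold moves the last column onto the one before it, with levels renamed by `ρ`, and fixes
  -- the other columns. Each point is `s`-related to its image, so the fold does not change the
  -- number of components.
  let q : Pt (n + 2) → Pt (n + 1) := fun p =>
    Fin.lastCases (ρ p.1, Fin.last n) (fun i => (p.1, i)) p.2
  have hql : ∀ a, q (a, Fin.last (n + 1)) = (ρ a, Fin.last n) := fun a => by simp [q]
  have hqc : ∀ a i, q (a, Fin.castSucc i) = (a, i) := fun a i => by simp [q]
  have hq2 : ∀ p, (q p).2 = (Fin.lastCases (Fin.last n) id p.2 : Fin (n + 1)) := by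
    rintro ⟨a, i⟩
    induction i using Fin.lastCases with
    | last => simp [hql]
    | cast i => simp [hqc]
  have hsq : ∀ p, s p (inclPt (q p)) := by
    rintro ⟨a, i⟩
    induction i using Fin.lastCases with
    | last => rw [hql]; exact hs a
    | cast i => rw [hqc]; exact s.refl' _
  have hsurj : Function.Surjective q := fun p => ⟨inclPt p, hqc _ _⟩
  have hker : Setoid.ker q ≤ s := fun p p' h => by
    have h' : q p = q p' := h
    exact s.trans' (hsq p) (h' ▸ s.symm' (hsq p'))
  rw [← card_quotient_map hsurj (hker.trans le_sup_right), closedCurves]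
  congr 2
  have hqi : q ∘ inclPt = id := funext fun p => hqc p.1 p.2
  have hrev : ∀ a b : Fin 2, b = a ∨ b = a.rev := by decide
  have hE : (E.rel.map inclPt).map q = E.rel := by
    rw [map_map, hqi]
    exact le_antisymm (map_le_iff.2 le_rfl) Setoid.le_comap_map
  rw [map_sup, show (addStrand E).rel = addLast E.rel from rfl, addLast, map_sup, hE]
  apply le_antisymm
  · refine sup_le (sup_le le_sup_left ?_) ?_
    · refine le_trans ?_ le_sup_right
      rw [map_le_iff, map_le_iff]
      intro a b _
      change (q _).2 = (q _).2
      rw [hq2, hq2]; rfl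
    · refine le_trans ?_ le_sup_right
      rw [map_le_iff]
      intro p p' h
      change (q _).2 = (q _).2
      rw [hq2, hq2]; exact hs'' h
  · refine sup_le (le_sup_left.trans le_sup_left) ?_
    rintro ⟨a, i⟩ ⟨b, j⟩ h
    obtain rfl : i = j := h
    induction i using Fin.lastCases with
    | last =>
      -- In the last column the closing arc is the folded image of the added strand. Bijectivity of
      -- `ρ` ensures that this image reaches both levels.
      refine (le_sup_right.trans le_sup_left :
        ((⊤ : Setoid (Fin 2)).map (lastPt (n + 1))).map q ≤ _) ?_
      obtain ⟨a, rfl⟩ := (Finite.injective_iff_surjective.1 hρ) a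
      obtain ⟨b, rfl⟩ := (Finite.injective_iff_surjective.1 hρ) b
      rw [← hql, ← hql, map_map]
      exact (Setoid.le_comap_map (f := q ∘ lastPt (n + 1)) (r := ⊤) (x := a) (y := b) trivial : _)
    | cast i =>
      -- In the other columns the closing arcs are the vertical pairs of `s`.
      refine (le_sup_right : s.map q ≤ _) ?_
      rcases hrev a b with rfl | rfl
      · exact Setoid.refl' _ _
      · rw [← hqc, ← hqc]
        exact (Setoid.le_comap_map (f := q) (hs' a i) : _)

end Stabilization

/-! ### Closing up with the last generator -/

section GeneratorClosures

variable {n : ℕ}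

/-- Since `flipPt` is an involution, invariance in one direction is enough. It applies to the
generators, so the reflection in `loops_add_closedCurves` can be dropped for them. -/
theorem map_flipPt_eq {r : Setoid (Pt n)} (h : ∀ p q, r p q → r (flipPt p) (flipPt q)) :
    r.map flipPt = r := by
  apply le_antisymm
  · rw [map_le_iff]; exact fun p q hpq => h p q hpq
  · intro p q hpq
    have h' := (Setoid.le_comap_map (f := flipPt) (h p q hpq) : r.map flipPt _ _)
    rwa [Setoid.comap_rel, flipPt_involutive p, flipPt_involutive q] at h'

theorem vTangle_rel_iff (i : Fin n) (p q : Pt (n + 1)) : (vTangle i).rel p q ↔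
    q = p ∨ q = (p.1.rev, Equiv.swap i.castSucc i.succ p.2) := Iff.rfl

theorem eTangle_rel_iff (i : Fin n) (a b : Fin 2) (j j' : Fin (n + 1)) :
    (eTangle i).rel (a, j) (b, j') ↔
      ((j = i.castSucc ∨ j = i.succ) ∧ (j' = i.castSucc ∨ j' = i.succ) ∧ a = b) ∨
        (¬ (j = i.castSucc ∨ j = i.succ) ∧ j = j') := by
  rw [eTangle_rel]; exact eCollapse_eq_iff i a b j j'

theorem map_flipPt_vTangle (i : Fin n) : (vTangle i).rel.map flipPt = (vTangle i).rel := by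
  refine map_flipPt_eq ?_
  rintro p q (rfl | rfl)
  · exact Or.inl rfl
  · exact Or.inr rfl

theorem map_flipPt_eTangle (i : Fin n) : (eTangle i).rel.map flipPt = (eTangle i).rel := by
  refine map_flipPt_eq ?_
  rintro ⟨a, j⟩ ⟨b, j'⟩ h
  refine (eTangle_rel_iff i _ _ _ _).2 (((eTangle_rel_iff i _ _ _ _).1 h).imp ?_ id)
  exact fun h => ⟨h.1, h.2.1, congrArg Fin.rev h.2.2⟩

theorem closedCurves_addStrand_eTangle (E : FlatTangle (n + 1)) :
    loops (addStrand E) (eTangle (Fin.last n)) +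
      closedCurves (concat (addStrand E) (eTangle (Fin.last n))) = closedCurves E := by
  rw [loops_add_closedCurves, map_flipPt_eTangle]
  -- The pairs of `E_n` in the last two columns are horizontal, so the fold preserves levels.
  refine card_quotient_fold E _ id Function.injective_id ?_ ?_ ?_
  · exact fun a => (eTangle_rel_iff _ _ _ _ _).2 (Or.inl ⟨Or.inr rfl, Or.inl rfl, rfl⟩)
  · refine fun a i => (eTangle_rel_iff _ _ _ _ _).2 (Or.inr ⟨?_, rfl⟩)
    simp only [Fin.ext_iff, Fin.val_castSucc, Fin.val_last, Fin.val_succ]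
    omega
  · rintro ⟨a, j⟩ ⟨b, j'⟩ h
    have key : ∀ j : Fin (n + 2), (j = (Fin.last n).castSucc ∨ j = (Fin.last n).succ) →
        (Fin.lastCases (Fin.last n) id j : Fin (n + 1)) = Fin.last n := by
      rintro j (rfl | rfl)
      · simp
      · rw [Fin.succ_last]; simp
    rcases (eTangle_rel_iff _ _ _ _ _).1 h with ⟨h1, h2, -⟩ | ⟨-, rfl⟩
    · exact (key j h1).trans (key j' h2).symm
    · rfl

theorem closedCurves_addStrand_vTangle (E : FlatTangle (n + 1)) :
    loops (addStrand E) (vTangle (Fin.last n)) +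
      closedCurves (concat (addStrand E) (vTangle (Fin.last n))) = closedCurves E := by
  rw [loops_add_closedCurves, map_flipPt_vTangle]
  -- The crossing strands of `v_n` join opposite levels, so the fold exchanges them.
  refine card_quotient_fold E _ Fin.rev Fin.rev_injective ?_ ?_ ?_
  · refine fun a => Or.inr (Prod.ext rfl ?_)
    rw [← Fin.succ_last]
    exact (Equiv.swap_apply_right _ _).symm
  · refine fun a i => Or.inr (Prod.ext rfl ?_)
    refine (Equiv.swap_apply_of_ne_of_ne ?_ ?_).symm <;>
    · simp only [ne_eq, Fin.ext_iff, Fin.val_castSucc, Fin.val_last, Fin.val_succ]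
      omega
  · rintro ⟨a, j⟩ q (rfl | rfl)
    · rfl
    · change (Fin.lastCases (Fin.last n) id j : Fin (n + 1)) = (Fin.lastCases (Fin.last n) id
        (Equiv.swap (Fin.last n).castSucc (Fin.last n).succ j) : Fin (n + 1))
      by_cases h1 : j = (Fin.last n).castSucc
      · rw [h1, Equiv.swap_apply_left, Fin.succ_last]; simp
      · by_cases h2 : j = (Fin.last n).succ
        · rw [h2, Equiv.swap_apply_right, Fin.succ_last]; simp
        · rw [Equiv.swap_apply_of_ne_of_ne h1 h2]

end GeneratorClosures

/-! ### Relations between the generating tangles -/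

section Relations

variable {n : ℕ}

/-- The exchange of the end points `i` and `i + 1` at the level `a`. -/
def twist (a : Fin 2) (i : Fin n) (p : Pt (n + 1)) : Pt (n + 1) :=
  (p.1, if p.1 = a then Equiv.swap i.castSucc i.succ p.2 else p.2)

/-- Multiplication by `v_i` only relabels end points, here those at level `0`. Products with `v_i`
can therefore be compared by substitution, without analysing a stack. -/
theorem vTangle_concat (i : Fin n) (E : FlatTangle (n + 1)) :
    (concat (vTangle i) E).rel = E.rel.comap (twist 0 i) ∧ loops (vTangle i) E = 0 := by
  -- Retract the stack onto the second diagram: a point of level `0` slides along its strand of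
  -- `v_i` to the swapped column of level `1`, which is level `0` of `E`.
  let χ : Fin 3 × Fin (n + 1) → Pt (n + 1) := fun p =>
    (![0, 0, 1] p.1, if p.1 = 0 then Equiv.swap i.castSucc i.succ p.2 else p.2)
  have h1 : stack (vTangle i) E ≤ E.rel.comap χ := by
    refine sup_le ?_ ?_ <;> rw [map_le_iff] <;> rintro ⟨a, j⟩ q h
    · rcases h with rfl | rfl
      · exact Setoid.refl' _ _
      · fin_cases a <;> simp [firstPt, χ, Setoid.comap_rel]
    · obtain ⟨b, j'⟩ := q
      have : ∀ a : Fin 2, (![0, 0, 1] a.succ : Fin 2) = a := by decide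
      simpa [secondPt, χ, Setoid.comap_rel, this, Fin.succ_ne_zero] using h
  have h2 : ∀ p, stack (vTangle i) E p (secondPt (χ p)) := by
    rintro ⟨a, j⟩
    fin_cases a
    · exact map_le_iff.1 (le_sup_left : _ ≤ stack (vTangle i) E)
        (x := (0, j)) (y := (1, Equiv.swap i.castSucc i.succ j)) (Or.inr rfl)
    · exact Setoid.refl' _ _
    · exact Setoid.refl' _ _
  have h3 : stack (vTangle i) E = E.rel.comap χ := by
    refine le_antisymm h1 fun p q h => ?_
    exact Setoid.trans' _ (h2 p) (Setoid.trans' _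
      (map_le_iff.1 (le_sup_right : _ ≤ stack (vTangle i) E) h) (Setoid.symm' _ (h2 q)))
  have h4 : χ ∘ outerPt = twist 0 i := by
    apply level_ext; intro a j; fin_cases a <;> rfl
  constructor
  · change (stack (vTangle i) E).comap outerPt = _
    rw [h3, ← Setoid.comap_comp, h4]
  · unfold loops freeClasses
    rw [Nat.card_eq_zero]
    refine Or.inl ⟨?_⟩
    rintro ⟨c, hc⟩
    induction c using Quotient.inductionOn with | _ x =>
    obtain ⟨a, j⟩ := x
    fin_cases a
    · exact hc (0, j) rfl
    -- A point of the middle level is joined by a strand of `v_i` to an outer point, so it lies on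
    -- no loop.
    · exact hc (0, Equiv.swap i.castSucc i.succ j) (Quotient.sound (Setoid.trans' _ (h2 _) (by
        simp [outerPt, χ, secondPt])))
    · exact hc (1, j) rfl

theorem concat_vTangle (i : Fin n) (E : FlatTangle (n + 1)) :
    (concat E (vTangle i)).rel = E.rel.comap (twist 1 i) ∧ loops E (vTangle i) = 0 := by
  let χ : Fin 3 × Fin (n + 1) → Pt (n + 1) := fun p =>
    (![0, 1, 1] p.1, if p.1 = 2 then Equiv.swap i.castSucc i.succ p.2 else p.2)
  have h1 : stack E (vTangle i) ≤ E.rel.comap χ := by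
    refine sup_le ?_ ?_ <;> rw [map_le_iff] <;> rintro ⟨a, j⟩ q h
    · obtain ⟨b, j'⟩ := q
      have h5 : ∀ a : Fin 2, (![0, 1, 1] a.castSucc : Fin 2) = a := by decide
      have h6 : ∀ a : Fin 2, a.castSucc ≠ 2 := by decide
      simpa only [firstPt, χ, Setoid.comap_rel, h5, h6, if_false] using h
    · rcases h with rfl | rfl
      · exact Setoid.refl' _ _
      · fin_cases a <;> simp [secondPt, χ, Setoid.comap_rel]
  have h2 : ∀ p, stack E (vTangle i) p (firstPt (χ p)) := by
    rintro ⟨a, j⟩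
    fin_cases a
    · exact Setoid.refl' _ _
    · exact Setoid.refl' _ _
    · exact map_le_iff.1 (le_sup_right : _ ≤ stack E (vTangle i))
        (x := (1, j)) (y := (0, Equiv.swap i.castSucc i.succ j)) (Or.inr rfl)
  have h3 : stack E (vTangle i) = E.rel.comap χ := by
    refine le_antisymm h1 fun p q h => ?_
    exact Setoid.trans' _ (h2 p) (Setoid.trans' _
      (map_le_iff.1 (le_sup_left : _ ≤ stack E (vTangle i)) h) (Setoid.symm' _ (h2 q)))
  have h4 : χ ∘ outerPt = twist 1 i := by
    apply level_ext; intro a j; fin_cases a <;> rfl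
  constructor
  · change (stack E (vTangle i)).comap outerPt = _
    rw [h3, ← Setoid.comap_comp, h4]
  · unfold loops freeClasses
    rw [Nat.card_eq_zero]
    refine Or.inl ⟨?_⟩
    rintro ⟨c, hc⟩
    induction c using Quotient.inductionOn with | _ x =>
    obtain ⟨a, j⟩ := x
    fin_cases a
    · exact hc (0, j) rfl
    · exact hc (1, Equiv.swap i.castSucc i.succ j) (Quotient.sound (Setoid.trans' _ (h2 _) (by
        simp [outerPt, χ, firstPt])))
    · exact hc (1, j) rfl

theorem vTangle_concat_vTangle (i : Fin n) : concat (vTangle i) (vTangle i) = idTangle (n + 1) := by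
  apply FlatTangle.ext
  -- Writing the second factor as the identity times `v_i` presents the product as the identity
  -- tangle twisted at both levels, and the two twists cancel.
  rw [(vTangle_concat i _).1, ← (id_concat_aux (vTangle i)).1, (concat_vTangle i _).1]
  ext ⟨a, j⟩ ⟨b, j'⟩
  rw [Setoid.comap_rel, Setoid.comap_rel, idTangle_rel, idTangle_rel]
  fin_cases a <;> fin_cases b <;> simp [twist]

theorem vTangle_concat_eTangle (i : Fin n) : concat (vTangle i) (eTangle i) = eTangle i := by
  apply FlatTangle.ext
  rw [(vTangle_concat i _).1]
  ext ⟨a, j⟩ ⟨b, j'⟩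
  rw [Setoid.comap_rel, twist, twist, eTangle_rel_iff, eTangle_rel_iff]
  have := swap_mem i
  have h := @Equiv.swap_apply_of_ne_of_ne _ _ i.castSucc i.succ
  dsimp only
  grind

theorem eTangle_concat_vTangle (i : Fin n) : concat (eTangle i) (vTangle i) = eTangle i := by
  apply FlatTangle.ext
  rw [(concat_vTangle i _).1]
  ext ⟨a, j⟩ ⟨b, j'⟩
  rw [Setoid.comap_rel, twist, twist, eTangle_rel_iff, eTangle_rel_iff]
  have := swap_mem i
  have h := @Equiv.swap_apply_of_ne_of_ne _ _ i.castSucc i.succ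
  dsimp only
  grind

theorem vTangle_braid (i : Fin n) :
    concat (vTangle i.succ) (concat (vTangle i.castSucc) (vTangle i.succ)) =
      concat (vTangle i.castSucc) (concat (vTangle i.succ) (vTangle i.castSucc)) := by
  apply FlatTangle.ext
  simp only [(vTangle_concat _ _).1]
  ext ⟨a, j⟩ ⟨b, j'⟩
  have h1 : i.castSucc.castSucc ≠ i.succ.castSucc := by simp [Fin.ext_iff]
  have h2 : i.castSucc.castSucc ≠ i.succ.succ := by simp [Fin.ext_iff]; omega
  have h3 : i.succ.castSucc ≠ i.succ.succ := by simp [Fin.ext_iff]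
  have h4 : i.castSucc.succ = i.succ.castSucc := rfl
  simp only [Setoid.comap_rel, vTangle_rel_iff, twist, Prod.mk.injEq,
    Equiv.swap_apply_def, h4]
  have hb : (Fin.rev 0 : Fin 2) = 1 := rfl
  have hc : (Fin.rev 1 : Fin 2) = 0 := rfl
  fin_cases a <;> fin_cases b <;> simp [hb, hc] <;> grind

/-- Conjugation by `v` permutes the columns at both levels. Either side is the tangle with
horizontal pairs in columns `i` and `i + 2` and a vertical strand in column `i + 1`. -/
theorem vTangle_conj_eTangle (i : Fin n) :
    concat (vTangle i.succ) (concat (eTangle i.castSucc) (vTangle i.succ)) =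
      concat (vTangle i.castSucc) (concat (eTangle i.succ) (vTangle i.castSucc)) := by
  apply FlatTangle.ext
  simp only [(vTangle_concat _ _).1, (concat_vTangle _ _).1]
  ext ⟨a, j⟩ ⟨b, j'⟩
  have h1 : i.castSucc.castSucc ≠ i.succ.castSucc := by simp [Fin.ext_iff]
  have h2 : i.castSucc.castSucc ≠ i.succ.succ := by simp [Fin.ext_iff]; omega
  have h3 : i.succ.castSucc ≠ i.succ.succ := by simp [Fin.ext_iff]
  have h4 : i.castSucc.succ = i.succ.castSucc := rfl
  have h5 : ∀ (k : Fin (n + 1)) (p : Pt (n + 2)),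
      twist 1 k (twist 0 k p) = (p.1, Equiv.swap k.castSucc k.succ p.2) := by
    rintro k ⟨a, j⟩; fin_cases a <;> rfl
  simp only [Setoid.comap_rel, h5, eTangle_rel_iff,
    Equiv.swap_apply_def, h4]
  grind

/-- In the middle the strand zigzags: it comes down column `i`, crosses to column `i + 2` by a pair
of `F`, returns to column `i + 1` by a pair of the first diagram, and is led back to column `i` by
the crossing. Pulled straight it is vertical, and it uses up all the middle pairs, so no loop is
left. -/
theorem eTangle_vTangle_eTangle (i : Fin n) :
    concat (eTangle i.succ) (concat (vTangle i.castSucc) (eTangle i.succ)) = eTangle i.succ ∧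
      loops (eTangle i.succ) (concat (vTangle i.castSucc) (eTangle i.succ)) = 0 := by
  have n1 : i.castSucc.castSucc ≠ i.succ.castSucc := by simp [Fin.ext_iff]
  have n2 : i.castSucc.castSucc ≠ i.succ.succ := by simp [Fin.ext_iff]; omega
  have n3 : i.succ.castSucc ≠ i.succ.succ := by simp [Fin.ext_iff]
  have n4 : i.castSucc.succ = i.succ.castSucc := rfl
  set F := concat (vTangle i.castSucc) (eTangle i.succ) with hF
  have hFrel : ∀ p q, F.rel p q ↔
      (eTangle i.succ).rel (twist 0 i.castSucc p) (twist 0 i.castSucc q) := by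
    intro p q
    rw [hF, (vTangle_concat _ _).1, Setoid.comap_rel]
  -- The middle points in columns `i + 1` and `i + 2` lie on the zigzag, hence are sent to its end
  -- in column `i`; other middle points move straight to level `0`.
  let φ : Fin 3 × Fin (n + 2) → Pt (n + 2) := fun p =>
    (![0, 0, 1] p.1, if p.1 = 1 ∧ (p.2 = i.succ.castSucc ∨ p.2 = i.succ.succ) then
      i.castSucc.castSucc else p.2)
  refine concat_of_collapse φ ?_ ?_
  · apply le_antisymm
    · refine sup_le ?_ ?_ <;> rw [map_le_iff] <;> rintro ⟨a, j⟩ ⟨b, j'⟩ h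
      · rw [eTangle_rel_iff] at h
        simp only [Setoid.comap_rel, firstPt, φ, eTangle_rel_iff]
        fin_cases a <;> fin_cases b <;> simp at h ⊢ <;> grind
      · simp only [hFrel, twist, eTangle_rel_iff, Equiv.swap_apply_def, n4] at h
        simp only [Setoid.comap_rel, secondPt, φ, eTangle_rel_iff]
        fin_cases a <;> fin_cases b <;> simp at h ⊢ <;> grind
    · have hf : ∀ a b j j', (eTangle i.succ).rel (a, j) (b, j') →
          stack (eTangle i.succ) F (a.castSucc, j) (b.castSucc, j') := fun a b j j' h =>
        map_le_iff.1 (le_sup_left : _ ≤ stack (eTangle i.succ) F) h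
      have hs : ∀ a b j j', F.rel (a, j) (b, j') →
          stack (eTangle i.succ) F (a.succ, j) (b.succ, j') := fun a b j j' h =>
        map_le_iff.1 (le_sup_right : _ ≤ stack (eTangle i.succ) F) h
      -- The turns of the zigzag: the first diagram joins columns `i + 1` and `i + 2`, and `F` joins
      -- column `i + 2` to column `i`.
      have hmid : ∀ j, (j = i.succ.castSucc ∨ j = i.succ.succ) →
          stack (eTangle i.succ) F (1, j) (1, i.castSucc.castSucc) := by
        intro j hj
        refine Setoid.trans' _ (hf 1 1 j i.succ.succ ?_) (hs 0 0 _ _ ?_)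
        · exact (eTangle_rel_iff _ _ _ _ _).2 (Or.inl ⟨hj, Or.inr rfl, rfl⟩)
        · simp only [hFrel, twist, eTangle_rel_iff, Equiv.swap_apply_def, n4]
          grind
      have hthrough : ∀ j, ¬ (j = i.succ.castSucc ∨ j = i.succ.succ) →
          stack (eTangle i.succ) F (1, j) (0, j) := fun j hj =>
        hf 1 0 j j ((eTangle_rel_iff _ _ _ _ _).2 (Or.inr ⟨hj, rfl⟩))
      have hbottom : ∀ j, ¬ (j = i.succ.castSucc ∨ j = i.succ.succ) →
          stack (eTangle i.succ) F (1, j) (2, j) := by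
        intro j hj
        by_cases hx : j = i.castSucc.castSucc
        · rw [hx]
          refine Setoid.trans' _ (Setoid.symm' _ (hmid _ (Or.inl rfl))) (hs 0 1 _ _ ?_)
          simp only [hFrel, twist, eTangle_rel_iff, Equiv.swap_apply_def, n4]
          grind
        · refine hs 0 1 j j ?_
          simp only [hFrel, twist, eTangle_rel_iff, Equiv.swap_apply_def, n4]
          grind
      have hcol : ∀ p, stack (eTangle i.succ) F p (outerPt (φ p)) := by
        rintro ⟨a, j⟩
        fin_cases a
        · exact Setoid.refl' _ _
        · by_cases hj : j = i.succ.castSucc ∨ j = i.succ.succ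
          · have hφ : φ (1, j) = (0, i.castSucc.castSucc) := Prod.ext rfl (if_pos ⟨rfl, hj⟩)
            have h := Setoid.trans' _ (hmid j hj) (hthrough _ (by grind))
            exact (congrArg outerPt hφ).symm ▸ h
          · have hφ : φ (1, j) = (0, j) := Prod.ext rfl (if_neg fun h => hj h.2)
            exact (congrArg outerPt hφ).symm ▸ hthrough j hj
        · exact Setoid.refl' _ _
      have houter : ∀ p q, (eTangle i.succ).rel p q →
          stack (eTangle i.succ) F (outerPt p) (outerPt q) := by
        rintro ⟨a, j⟩ ⟨b, j'⟩ h
        rcases (eTangle_rel_iff _ _ _ _ _).1 h with ⟨h1, h2, rfl⟩ | ⟨hj, rfl⟩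
        · fin_cases a
          · exact hf 0 0 j j' h
          · refine hs 1 1 j j' ?_
            exact (hFrel _ _).2 ((eTangle_rel_iff _ _ _ _ _).2 (Or.inl ⟨h1, h2, rfl⟩))
        · have hout : ∀ c : Fin 2, stack (eTangle i.succ) F (1, j) (outerPt (c, j)) := by
            intro c
            fin_cases c
            · exact hthrough j hj
            · exact hbottom j hj
          exact Setoid.trans' _ (Setoid.symm' _ (hout a)) (hout b)
      intro p q h
      exact Setoid.trans' _ (hcol p) (Setoid.trans' _ (houter _ _ h) (Setoid.symm' _ (hcol q)))
  · rintro ⟨a, j⟩; fin_cases a <;> simp [φ, outerPt]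

end Relations

/-! ### The trace form and the generators of the algebra -/

section TraceForm

open LaurentPolynomial

variable {n : ℕ}

theorem addStrand_vTangle (i : Fin n) : addStrand (vTangle i) = vTangle i.castSucc := by
  apply FlatTangle.ext
  ext p q
  change addLast (vTangle i).rel p q ↔ _
  have hswap : ∀ j : Fin (n + 1), Equiv.swap i.castSucc.castSucc i.castSucc.succ j.castSucc =
      (Equiv.swap i.castSucc i.succ j).castSucc := fun j =>
    (Fin.castSucc_injective (n + 1)).swap_apply i.castSucc i.succ j
  have hlast : Equiv.swap i.castSucc.castSucc i.castSucc.succ (Fin.last (n + 1)) =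
      Fin.last (n + 1) := by
    refine Equiv.swap_apply_of_ne_of_ne ?_ ?_ <;>
    · simp only [ne_eq, Fin.ext_iff, Fin.val_castSucc, Fin.val_last, Fin.val_succ]
      omega
  have hrev : ∀ a b : Fin 2, b = a ∨ b = a.rev := by decide
  rcases pt_cases p with ⟨⟨a, j⟩, rfl⟩ | ⟨a, rfl⟩ <;>
    rcases pt_cases q with ⟨⟨b, j'⟩, rfl⟩ | ⟨b, rfl⟩
  · rw [addLast_incl, vTangle_rel_iff, vTangle_rel_iff]
    simp only [inclPt, hswap, Prod.mk.injEq, Fin.castSucc_inj]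
  · refine ⟨fun h => (addLast_incl_last _ _ _ h).elim, ?_⟩
    rintro (h | h)
    · exact ((Fin.castSucc_lt_last j).ne (congrArg Prod.snd h).symm).elim
    · exact ((Fin.castSucc_lt_last _).ne ((hswap j).symm.trans (congrArg Prod.snd h).symm)).elim
  · refine ⟨fun h => (addLast_incl_last _ _ _ (Setoid.symm' _ h)).elim, ?_⟩
    rintro (h | h)
    · exact ((Fin.castSucc_lt_last j').ne (congrArg Prod.snd h)).elim
    · exact ((Fin.castSucc_lt_last j').ne ((congrArg Prod.snd h).trans hlast)).elim
  · refine ⟨fun _ => ?_, fun _ => addLast_last _ _ _⟩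
    exact (hrev a b).imp (fun h => Prod.ext h rfl) (fun h => Prod.ext h hlast.symm)

theorem traceForm_of (E : FlatTangle n) :
    traceForm n (VTL.of _ _ E) = loopValue ^ closedCurves E := VTL.lift_of _ _

theorem traceForm_of_mul_of (E E' : FlatTangle n) : traceForm n (VTL.of _ _ E * VTL.of _ _ E') =
    loopValue ^ (loops E E' + closedCurves (concat E E')) := by
  rw [VTL.of_mul_of, map_smul, traceForm_of, smul_eq_mul, pow_add]

theorem traceForm_mul_comm (x y : VTLf n) : traceForm n (x * y) = traceForm n (y * x) := by
  induction x using VTL.induction with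
  | hadd x x' h h' => simp only [add_mul, mul_add, map_add, h, h']
  | hsmul a x h => simp only [smul_mul_assoc, mul_smul_comm, map_smul, h]
  | hof E =>
    induction y using VTL.induction with
    | hadd x x' h h' => simp only [add_mul, mul_add, map_add, h, h']
    | hsmul a x h => simp only [smul_mul_assoc, mul_smul_comm, map_smul, h]
    | hof E' => rw [traceForm_of_mul_of, traceForm_of_mul_of, loops_add_closedCurves_comm]

theorem inclf_of (E : FlatTangle n) :
    inclf n (VTL.of _ _ E) = VTL.of _ _ (addStrand E) := VTL.lift_of _ _

theorem traceForm_inclf (x : VTLf n) :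
    traceForm (n + 1) (inclf n x) = loopValue * traceForm n x := by
  induction x using VTL.induction with
  | hadd x x' h h' => simp only [map_add, mul_add, h, h']
  | hsmul a x h => simp only [map_smul, h, smul_eq_mul, mul_left_comm]
  | hof E => rw [inclf_of, traceForm_of, traceForm_of, closedCurves_addStrand, pow_succ']

theorem traceForm_inclf_mul_eGen (x : VTLf (n + 1)) :
    traceForm (n + 2) (inclf (n + 1) x * eGen (n + 1) (Fin.last n)) = traceForm (n + 1) x := by
  induction x using VTL.induction with
  | hadd x x' h h' => simp only [map_add, add_mul, h, h']
  | hsmul a x h => simp only [map_smul, smul_mul_assoc, h]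
  | hof E =>
    rw [inclf_of, eGen, traceForm_of_mul_of, closedCurves_addStrand_eTangle, traceForm_of]

theorem traceForm_inclf_mul_vGen (x : VTLf (n + 1)) :
    traceForm (n + 2) (inclf (n + 1) x * vGen (n + 1) (Fin.last n)) = traceForm (n + 1) x := by
  induction x using VTL.induction with
  | hadd x x' h h' => simp only [map_add, add_mul, h, h']
  | hsmul a x h => simp only [map_smul, smul_mul_assoc, h]
  | hof E =>
    rw [inclf_of, vGen, traceForm_of_mul_of, closedCurves_addStrand_vTangle, traceForm_of]

/-- This lets `v_{n-1}` be absorbed into `x`, so that the rules for a product of an included element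
with `E_n` apply. -/
theorem inclf_vGen (i : Fin n) : inclf (n + 1) (vGen n i) = vGen (n + 1) i.castSucc := by
  rw [vGen, inclf_of, addStrand_vTangle, vGen]

theorem vGen_mul_of (i : Fin n) (E : FlatTangle (n + 1)) :
    vGen n i * VTL.of _ _ E = VTL.of _ _ (concat (vTangle i) E) := by
  rw [vGen, VTL.of_mul_of, (vTangle_concat i E).2, pow_zero, one_smul]

theorem of_mul_vGen (i : Fin n) (E : FlatTangle (n + 1)) :
    VTL.of _ _ E * vGen n i = VTL.of _ _ (concat E (vTangle i)) := by
  rw [vGen, VTL.of_mul_of, (concat_vTangle i E).2, pow_zero, one_smul]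

theorem vGen_mul_vGen (i : Fin n) : vGen n i * vGen n i = 1 := by
  have h := vGen_mul_of i (vTangle i)
  rw [vTangle_concat_vTangle] at h
  exact h

theorem vGen_mul_eGen (i : Fin n) : vGen n i * eGen n i = eGen n i := by
  rw [eGen, vGen_mul_of, vTangle_concat_eTangle]

theorem eGen_mul_vGen (i : Fin n) : eGen n i * vGen n i = eGen n i := by
  rw [eGen, of_mul_vGen, eTangle_concat_vTangle]

theorem vGen_braid (i : Fin n) :
    vGen (n + 1) i.succ * (vGen (n + 1) i.castSucc * vGen (n + 1) i.succ) =
      vGen (n + 1) i.castSucc * (vGen (n + 1) i.succ * vGen (n + 1) i.castSucc) := by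
  have h := congrArg (VTL.of ℤ[T;T⁻¹] loopValue) (vTangle_braid i)
  rwa [← vGen_mul_of, ← vGen_mul_of, ← vGen_mul_of, ← vGen_mul_of] at h

theorem vGen_conj_eGen (i : Fin n) :
    vGen (n + 1) i.succ * (eGen (n + 1) i.castSucc * vGen (n + 1) i.succ) =
      vGen (n + 1) i.castSucc * (eGen (n + 1) i.succ * vGen (n + 1) i.castSucc) := by
  have h := congrArg (VTL.of ℤ[T;T⁻¹] loopValue) (vTangle_conj_eTangle i)
  rwa [← vGen_mul_of, ← vGen_mul_of, ← of_mul_vGen, ← of_mul_vGen] at h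

theorem eGen_mul_vGen_mul_eGen (i : Fin n) :
    eGen (n + 1) i.succ * (vGen (n + 1) i.castSucc * eGen (n + 1) i.succ) =
      eGen (n + 1) i.succ := by
  have h := eTangle_vTangle_eTangle i
  rw [eGen, vGen_mul_of, VTL.of_mul_of, h.1, h.2, pow_zero, one_smul]

/-! ### Conjugation by the elements `S_i` and the Markov moves -/

theorem coe_sGen (i : Fin n) : (sGen n i : VTLf (n + 1)) =
    -(T (-2) : ℤ[T;T⁻¹]) • (1 : VTLf (n + 1)) - (T (-4) : ℤ[T;T⁻¹]) • eGen n i := rfl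

theorem coe_inv_sGen (i : Fin n) : (↑(sGen n i)⁻¹ : VTLf (n + 1)) =
    -(T 2 : ℤ[T;T⁻¹]) • (1 : VTLf (n + 1)) - (T 4 : ℤ[T;T⁻¹]) • eGen n i := rfl

/-- A bare expansion for arbitrary `v`: the powers of `A` cancel in the two outer terms, and no
relation for `E_i` is used. -/
theorem sGen_conj (i : Fin n) (v : VTLf (n + 1)) : (sGen n i : VTLf (n + 1)) * v * ↑(sGen n i)⁻¹ =
    v + (T 2 : ℤ[T;T⁻¹]) • (v * eGen n i) + (T (-2) : ℤ[T;T⁻¹]) • (eGen n i * v) +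
      eGen n i * v * eGen n i := by
  have h0 : (T (-2) * T 2 : ℤ[T;T⁻¹]) = 1 := by rw [← T_add]; rfl
  have h1 : (T (-4) * T 4 : ℤ[T;T⁻¹]) = 1 := by rw [← T_add]; rfl
  have h2 : (T (-2) * T 4 : ℤ[T;T⁻¹]) = T 2 := by rw [← T_add]; rfl
  have h3 : (T (-4) * T 2 : ℤ[T;T⁻¹]) = T (-2) := by rw [← T_add]; rfl
  rw [coe_sGen, coe_inv_sGen]
  simp only [sub_mul, mul_sub, smul_mul_assoc, mul_smul_comm, smul_smul, smul_sub, one_mul, mul_one,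
    neg_smul, smul_neg, neg_mul, mul_neg, h0, h1, h2, h3, mul_comm (T 2 : ℤ[T;T⁻¹]),
    mul_comm (T 4 : ℤ[T;T⁻¹]), one_smul]
  abel

theorem sGen_conj' (i : Fin n) (v : VTLf (n + 1)) : (↑(sGen n i)⁻¹ : VTLf (n + 1)) * v * sGen n i =
    v + (T (-2) : ℤ[T;T⁻¹]) • (v * eGen n i) + (T 2 : ℤ[T;T⁻¹]) • (eGen n i * v) +
      eGen n i * v * eGen n i := by
  have h0 : (T 2 * T (-2) : ℤ[T;T⁻¹]) = 1 := by rw [← T_add]; rfl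
  have h1 : (T 4 * T (-4) : ℤ[T;T⁻¹]) = 1 := by rw [← T_add]; rfl
  have h2 : (T 2 * T (-4) : ℤ[T;T⁻¹]) = T (-2) := by rw [← T_add]; rfl
  have h3 : (T 4 * T (-2) : ℤ[T;T⁻¹]) = T 2 := by rw [← T_add]; rfl
  rw [coe_sGen, coe_inv_sGen]
  simp only [sub_mul, mul_sub, smul_mul_assoc, mul_smul_comm, smul_smul, smul_sub, one_mul, mul_one,
    neg_smul, smul_neg, neg_mul, mul_neg, h0, h1, h2, h3, mul_comm (T (-2) : ℤ[T;T⁻¹]),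
    mul_comm (T (-4) : ℤ[T;T⁻¹]), one_smul]
  abel

theorem traceForm_inclf_mul_sGen (x : VTLf (n + 1)) :
    traceForm (n + 2) (inclf (n + 1) x * sGen (n + 1) (Fin.last n)) = traceForm (n + 1) x := by
  have h0 : (T (-2) * T 2 : ℤ[T;T⁻¹]) = 1 := by rw [← T_add]; rfl
  have h1 : (T (-2) * T (-2) : ℤ[T;T⁻¹]) = T (-4) := by rw [← T_add]; rfl
  rw [coe_sGen, mul_sub, mul_smul_comm, mul_smul_comm, mul_one, map_sub, map_smul, map_smul,
    traceForm_inclf, traceForm_inclf_mul_eGen, loopValue, smul_eq_mul, smul_eq_mul]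
  -- The coefficient is `-A⁻² z - A⁻⁴ = (1 + A⁻⁴) - A⁻⁴ = 1`.
  linear_combination (h0 + h1) * traceForm (n + 1) x

theorem traceForm_inclf_mul_inv_sGen (x : VTLf (n + 1)) :
    traceForm (n + 2) (inclf (n + 1) x * ↑(sGen (n + 1) (Fin.last n))⁻¹) =
      traceForm (n + 1) x := by
  have h0 : (T 2 * T (-2) : ℤ[T;T⁻¹]) = 1 := by rw [← T_add]; rfl
  have h1 : (T 2 * T 2 : ℤ[T;T⁻¹]) = T 4 := by rw [← T_add]; rfl
  rw [coe_inv_sGen, mul_sub, mul_smul_comm, mul_smul_comm, mul_one, map_sub, map_smul, map_smul,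
    traceForm_inclf, traceForm_inclf_mul_eGen, loopValue, smul_eq_mul, smul_eq_mul]
  linear_combination (h0 + h1) * traceForm (n + 1) x

theorem traceForm_stab_right (x : VTLf (n + 2)) :
    traceForm (n + 3) (inclf (n + 2) x * ↑(sGen (n + 2) (Fin.last (n + 1)))⁻¹ *
      vGen (n + 2) (Fin.last n).castSucc * sGen (n + 2) (Fin.last (n + 1))) =
      traceForm (n + 2) x := by
  rw [mul_assoc, mul_assoc, ← mul_assoc (↑(sGen (n + 2) (Fin.last (n + 1)))⁻¹ : VTLf (n + 3)),
    sGen_conj']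
  have hfuf := eGen_mul_vGen_mul_eGen (Fin.last n)
  rw [Fin.succ_last] at hfuf
  rw [mul_assoc, hfuf, ← inclf_vGen]
  simp only [mul_add, mul_smul_comm, map_add, map_smul, ← mul_assoc, ← map_mul]
  -- In the term `x E_n v_{n-1}` the factor `v_{n-1}` is first moved cyclically to the front. The
  -- first three terms are then multiples of `T (x v_{n-1})` whose coefficients `z`, `A⁻²`, `A²` add
  -- up to zero.
  rw [traceForm_inclf, traceForm_inclf_mul_eGen, traceForm_inclf_mul_eGen,
    traceForm_mul_comm (_ * eGen _ _), ← mul_assoc, ← map_mul, traceForm_inclf_mul_eGen,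
    traceForm_mul_comm (vGen _ _), loopValue, smul_eq_mul, smul_eq_mul]
  ring

theorem traceForm_stab_left (x : VTLf (n + 2)) :
    traceForm (n + 3) (inclf (n + 2) x * vGen (n + 2) (Fin.last (n + 1)) *
      vGen (n + 2) (Fin.last n).castSucc * sGen (n + 2) (Fin.last n).castSucc *
      vGen (n + 2) (Fin.last (n + 1)) * ↑(sGen (n + 2) (Fin.last n).castSucc)⁻¹ *
      vGen (n + 2) (Fin.last n).castSucc * vGen (n + 2) (Fin.last (n + 1))) =
      traceForm (n + 2) x := by
  have hfuf := eGen_mul_vGen_mul_eGen (Fin.last n)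
  have hbraid := vGen_braid (Fin.last n)
  have hconj := vGen_conj_eGen (Fin.last n)
  have huu := vGen_mul_vGen (Fin.last n).castSucc
  have hww := vGen_mul_vGen (Fin.last (n + 1))
  have hue := vGen_mul_eGen (Fin.last n).castSucc
  have heu := eGen_mul_vGen (Fin.last n).castSucc
  have hwf := vGen_mul_eGen (Fin.last (n + 1))
  have hfw := eGen_mul_vGen (Fin.last (n + 1))
  rw [Fin.succ_last] at hfuf hbraid hconj
  have hu := inclf_vGen (Fin.last n)
  have htf := traceForm_inclf_mul_eGen (n := n + 1)
  have hconjS := sGen_conj (Fin.last n).castSucc (vGen (n + 2) (Fin.last (n + 1)))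
  set u' := vGen (n + 1) (Fin.last n)
  have huu' : u' * u' = 1 := vGen_mul_vGen _
  set u := vGen (n + 2) (Fin.last n).castSucc
  set w := vGen (n + 2) (Fin.last (n + 1))
  set e := eGen (n + 2) (Fin.last n).castSucc
  set f := eGen (n + 2) (Fin.last (n + 1))
  have huu2 : ∀ y, u * (u * y) = y := fun y => by rw [← mul_assoc, huu, one_mul]
  have hww2 : ∀ y, w * (w * y) = y := fun y => by rw [← mul_assoc, hww, one_mul]
  have hbraid2 : ∀ y, w * (u * (w * y)) = u * (w * (u * y)) := fun y => by
    simpa only [mul_assoc] using congrArg (· * y) hbraid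
  have hconj2 : ∀ y, w * (e * (w * y)) = u * (f * (u * y)) := fun y => by
    simpa only [mul_assoc] using congrArg (· * y) hconj
  have heu2 : ∀ y, e * (u * y) = e * y := fun y => by rw [← mul_assoc, heu]
  have hue2 : ∀ y, u * (e * y) = e * y := fun y => by rw [← mul_assoc, hue]
  have hfw2 : ∀ y, f * (w * y) = f * y := fun y => by rw [← mul_assoc, hfw]
  have hwf2 : ∀ y, w * (f * y) = f * y := fun y => by rw [← mul_assoc, hwf]
  have hfuf2 : ∀ y, f * (u * (f * y)) = f * y := fun y => by
    simpa only [mul_assoc] using congrArg (· * y) hfuf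
  -- `E_{n-1}` is conjugate to `E_n` by `w u`, which allows relations for `f` to be transported to
  -- `e`.
  have he : e = w * (u * (f * (u * w))) := by
    rw [← hconj2, hww2, hww, mul_one]
  -- The conjugate of `f u f = f`: the inner word `f u w u f` becomes `f w u w f` by the braid
  -- relation, and the outer `w` are absorbed by `f`.
  have hewe : e * (w * e) = e := by
    calc e * (w * e) = w * (u * (f * (u * w))) * (w * (w * (u * (f * (u * w))))) := by
          rw [← he]
      _ = w * (u * (f * (u * w))) := by
          simp only [mul_assoc, hww2]
          rw [← hbraid2, hfw2, hwf2, hfuf2]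
      _ = e := he.symm
  have hewe2 : ∀ y, e * (w * (e * y)) = e * y := fun y => by
    simpa only [mul_assoc] using congrArg (· * y) hewe
  -- The four terms of `S_{n-1} w S_{n-1}⁻¹`, each conjugated by `w u`, become words in `u` and `f`
  -- alone.
  have h1 : w * (u * (w * (u * w))) = u := by rw [hbraid2, huu2, hww, mul_one]
  have h2 : w * (u * (w * (e * (u * w)))) = f * u := by
    rw [hbraid2, hue2, heu2, hconj, huu2]
  have h3 : w * (u * (e * (w * (u * w)))) = u * f := by
    rw [hue2, hbraid, heu2, hconj2, huu, mul_one]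
  have h4 : w * (u * (e * (w * (e * (u * w))))) = u * (f * u) := by
    rw [hue2, heu2, hewe2, hconj]
  have hexp : inclf (n + 2) x * w * u * sGen (n + 2) (Fin.last n).castSucc * w *
      ↑(sGen (n + 2) (Fin.last n).castSucc)⁻¹ * u * w =
      inclf (n + 2) x * u + (T 2 : ℤ[T;T⁻¹]) • (inclf (n + 2) x * f * u) +
        (T (-2) : ℤ[T;T⁻¹]) • (inclf (n + 2) x * u * f) + inclf (n + 2) x * u * f * u := by
    calc _ = inclf (n + 2) x * (w * (u * ((sGen (n + 2) (Fin.last n).castSucc * w *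
          ↑(sGen (n + 2) (Fin.last n).castSucc)⁻¹) * (u * w)))) := by simp only [mul_assoc]
      _ = _ := by
        rw [hconjS]
        simp only [add_mul, mul_add, smul_mul_assoc, mul_smul_comm, mul_assoc, h1, h2, h3, h4]
  rw [hexp, map_add, map_add, map_add, map_smul, map_smul, traceForm_mul_comm (_ * f) u,
    traceForm_mul_comm (_ * f) u, ← hu]
  simp only [← mul_assoc, ← map_mul]
  -- Once the trailing `u` has been moved to the front, each `f` is removed by stabilization. Three
  -- terms are multiples of `T (x u')` with coefficients adding up to `z + A² + A⁻² = 0`; the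
  -- remaining one is `T (u' x u') = T x`.
  rw [htf, htf, htf, traceForm_inclf, traceForm_mul_comm u' x, traceForm_mul_comm (u' * x) u',
    ← mul_assoc, huu', one_mul, loopValue, smul_eq_mul, smul_eq_mul]
  ring

end TraceForm

end VirtualTL

/-- The linear forms `E ↦ z ^ t(E)` on the tower of virtual Temperley–Lieb algebras over
`ℤ[A, A⁻¹]`, with `z = -A² - A⁻²` and `S_i = -A⁻² - A⁻⁴ E_i`, form a Markov trace. -/
theorem theorem2p6 :
    VirtualTL.IsMarkovTrace VirtualTL.VTLf VirtualTL.inclf VirtualTL.sGen VirtualTL.vGen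
      VirtualTL.traceForm := by
  exact
    { trace := fun _ _ => VirtualTL.traceForm_mul_comm
      stab_S := fun _ x => (VirtualTL.traceForm_inclf_mul_sGen x).symm
      stab_S_inv := fun _ x => (VirtualTL.traceForm_inclf_mul_inv_sGen x).symm
      stab_v := fun _ x => (VirtualTL.traceForm_inclf_mul_vGen x).symm
      stab_right := fun _ x => (VirtualTL.traceForm_stab_right x).symm
      stab_left := fun _ x => (VirtualTL.traceForm_stab_left x).symm }
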